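/- Let $F$ be a free group of finite rank $\ge 2$. \textbf{Free splittings and maps.} A \emph{free splitting} of $F$ is a minimal simplicial action of $F$ on a simplicial tree $T$, not a point, such that every edge ("edgelet") has trivial setwise stabilizer. \emph{Natural vertices} are those of valence $\ge 3$; a \emph{natural edge} is an arc whose endpoints are natural vertices and whose interior contains none; a subgraph is \emph{natural} if it contains every natural edge of which it contains an edgelet. Subgraphs, in particular preimages of subgraphs, are taken as unions of edgelets (degenerate components are ignored). A \emph{map} is an $F$-equivariant simplicial map. A map $S\to T$ is a \emph{collapse map} if it is injective over the interior of each edgelet of $T$; its \emph{collapse graph} is the union of the edgelets of $S$ that it sends to vertices. A \emph{conjugacy} is an $F$-equivariant homeomorphism (not necessarily simplicial). The \emph{gates} of a map $f$, nonconstant on every edgelet, at a vertex $x$ are the nonempty fibers of the map induced by $f$ from the directions at $x$ to the directions at $f(x)$. The map $f$ is \emph{foldable} if it is injective on each edgelet, has $\ge 2$ gates at every vertex and $\ge 3$ gates at every natural vertex. \textbf{Sequences.} A sequence of maps $S_i\to\cdots\to S_j$, with composed maps $f^a_b\colon S_a\to S_b$ ($f^a_a=\mathrm{id}$), is a \emph{foldable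 sequence} if $f^k_j$ is foldable for $i\le k\le j$. It is a \emph{fold sequence} if $f^i_j$ is foldable and, for $i\le k<j$, $S_k\to S_{k+1}$ is a \emph{maximal fold factor} of $f^k_j$: it is a foldable map, and there are distinct oriented natural edges $\eta,\eta'$ of $S_k$ with the same initial vertex such that $S_k\to S_{k+1}$ is the quotient map given by equivariantly identifying initial segments $e\subset\eta$ and $e'\subset\eta'$ with the same positive number of edgelets, where $e,e'$ are the maximal initial segments with $f^k_j(e)=f^k_j(e')$. A \emph{combing rectangle} from a sequence $S_i\to\cdots\to S_j$ (maps $f_k\colon S_{k-1}\to S_k$) to a sequence $T_i\to\cdots\to T_j$ is a commutative diagram with vertical collapse maps $\pi_k\colon S_k\to T_k$ with collapse graphs $\sigma_k$, such that the $S$-row is a foldable sequence and $\sigma_{k-1}=f_k^{-1}(\sigma_k)$ for $i<k\le j$. \textbf{Free splitting units.} Let $S_0\to\cdots\to S_J$ be a fold sequence. For $i<j$, $S_i,S_j$ \emph{differ by less than one free splitting unit} if there are combing rectangles from $S_i\to\cdots\to S_j$ and from some foldable sequence $T_i\to\cdots\to T_j$ to a common sequence $S'_i\to\cdots\to S'_j$,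 such that $T_i\to\cdots\to T_j$ has one of the following: (a) a natural invariant blue--red decomposition of constant complexity, i.e. for each $k$ nonempty $F$-invariant natural subgraphs $\beta_k,\rho_k$ with union $T_k$ and without common edgelets, such that $\beta_a,\rho_a$ are the preimages of $\beta_b,\rho_b$ under $T_a\to T_b$ for $a\le b$, and such that $C(\beta_k)=C_1(\beta_k)+(\operatorname{rank}(F)-C_2(\beta_k))$ does not depend on $k$, where $C_1$ is the number of $F$-orbits of components of $\beta_k$ and $C_2$ is the sum, over these orbits, of the ranks of the stabilizers of the components; (b) an almost invariant edge, i.e. natural edges $e_k\subset T_k$ such that for $a<b$ there is exactly one arc in $T_a$ that is mapped isomorphically onto $e_b$ by $T_a\to T_b$, and $e_a$ is the natural edge containing it. The \emph{number of free splitting units} between $S_I$ and $S_J$ ($I\le J$) is the largest $n$ for which there are $I\le i(0)<\cdots<i(n)\le J$ such that no two consecutive $S_{i(u-1)},S_{i(u)}$ differ by less than one free splitting unit. \textbf{Proposition.} Let $0\le I\le J$ and let $T^m_0\to\cdots\to T^m_J$, $m=0,\dots,4$, be sequences of free splittings of $F$ and maps, the first of which ($m=0$) is a fold sequence. Suppose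 given four combing rectangles (columns $0,\dots,J$), from the $T^0$ row to the $T^1$ row, from the $T^2$ row to the $T^1$ row with collapse graphs $\rho_j\subset T^2_j$, from the $T^2$ row to the $T^3$ row with collapse graphs $\beta_j\subset T^2_j$, and from the $T^4$ row to the $T^3$ row. Suppose that $T^2_J=\beta_J\cup\rho_J$, and that the number of free splitting units between $T^0_I$ and $T^0_J$ is at least $4\operatorname{rank}(F)-3$. Then there exist foldable sequences $T^{h1}_0\to\cdots\to T^{h1}_I$ and $T^{h3}_0\to\cdots\to T^{h3}_I$ such that: (1) there are combing rectangles (columns $0,\dots,I$) from the $T^1$ row to the $T^{h1}$ row and from the $T^3$ row to the $T^{h3}$ row, and their compositions with the given rectangles are combing rectangles from $T^0_0\to\cdots\to T^0_I$ to $T^{h1}_0\to\cdots\to T^{h1}_I$ and from $T^4_0\to\cdots\to T^4_I$ to $T^{h3}_0\to\cdots\to T^{h3}_I$; (2) there are (not necessarily simplicial) conjugacies $\xi_j\colon T^{h1}_j\to T^{h3}_j$, $0\le j\le I$, which commute with the horizontal maps: $\xi_{j+1}\circ(T^{h1}_j\to T^{h1}_{j+1})=(T^{h3}_j\to T^{h3}_{j+1})\circ\xi_j$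 for $0\le j<I$. -/

import Mathlib

universe u v

noncomputable section

/-- The rank of a free group: the cardinality of a free basis. -/
def freeRank (G : Type u) [Group G] [IsFreeGroup G] : ℕ :=
  Nat.card (IsFreeGroup.Generators G)

/-- A free splitting of `F`: a simplicial tree which is not a point, with a minimal simplicial
action of `F` such that the (setwise) stabilizer of every edgelet is trivial.
Simplicial trees are given by their vertex set and adjacency relation. -/
structure FreeSplitting (F : Type u) [Group F] where
  V : Type v
  graph : SimpleGraph V
  act : MulAction F V
  isTree : graph.IsTree
  nontrivial : Nontrivial V
  smul_adj : ∀ (g : F) (a b : V), graph.Adj a b → graph.Adj (g • a) (g • b)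
  minimal : ∀ s : Set V, s.Nonempty → (∀ (g : F), ∀ x ∈ s, g • x ∈ s) →
    (graph.induce s).Connected → s = Set.univ
  edge_stab : ∀ (g : F) (a b : V), graph.Adj a b → s(g • a, g • b) = s(a, b) → g = 1

namespace FreeSplitting

variable {F : Type u} [Group F]

instance (T : FreeSplitting.{u, v} F) : MulAction F T.V := T.act

/-- Natural vertices: those of valence at least three. -/
def IsNatural (T : FreeSplitting.{u, v} F) (x : T.V) : Prop :=
  3 ≤ (T.graph.neighborSet x).encard

/-- An oriented natural edge, given by the list of its consecutive vertices: an arc whose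
endpoints are natural vertices and whose interior vertices are not. Its edgelets are the
`[a, b]` with `[a, b] <:+: p`. -/
structure IsNaturalEdge (T : FreeSplitting.{u, v} F) (p : List T.V) : Prop where
  chain : p.IsChain T.graph.Adj
  nodup : p.Nodup
  two_le : 2 ≤ p.length
  natural_iff : ∀ (i : ℕ) (h : i < p.length), T.IsNatural p[i] ↔ i = 0 ∨ i + 1 = p.length

/-- A map of free splittings: an `F`-equivariant simplicial map. A simplicial map takes each
edgelet to a vertex or an edgelet, and it is determined by its values on vertices. -/
structure IsMap (S T : FreeSplitting.{u, v} F) (f : S.V → T.V) : Prop where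
  simplicial : ∀ a b : S.V, S.graph.Adj a b → f a = f b ∨ T.graph.Adj (f a) (f b)
  equivariant : ∀ (g : F) (a : S.V), f (g • a) = g • f a

/-- Maps of free splittings, bundled. -/
structure Hom (S T : FreeSplitting.{u, v} F) where
  toFun : S.V → T.V
  isMap : IsMap S T toFun

def Hom.id (S : FreeSplitting.{u, v} F) : Hom S S where
  toFun := fun x => x
  isMap := ⟨fun _ _ h => Or.inr h, fun _ _ => rfl⟩

def Hom.comp {S T U : FreeSplitting.{u, v} F} (g : Hom T U) (f : Hom S T) : Hom S U where
  toFun := fun x => g.toFun (f.toFun x)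
  isMap := by
    refine ⟨fun a b h => ?_, fun γ a => ?_⟩
    · rcases f.isMap.simplicial a b h with h | h
      · exact Or.inl (by rw [h])
      · exact g.isMap.simplicial _ _ h
    · rw [f.isMap.equivariant, g.isMap.equivariant]

/-- A collapse map: a map which is injective over the interior of each edgelet of the target,
i.e. two edgelets with the same image edgelet coincide. Its collapsed subgraph consists of the
edgelets `a b` with `f a = f b`. -/
structure IsCollapse (S T : FreeSplitting.{u, v} F) (f : S.V → T.V) : Prop extends
    IsMap S T f where
  inj_over : ∀ a b c d : S.V, S.graph.Adj a b → S.graph.Adj c d → f a ≠ f b →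
    f a = f c → f b = f d → a = c ∧ b = d

/-- A foldable map: injective on edgelets, at least two gates at every vertex and at least three
gates at every natural vertex. The gates at `x` correspond to the directions at `f x` which are
images of directions at `x`. -/
structure IsFoldable (S T : FreeSplitting.{u, v} F) (f : S.V → T.V) : Prop extends
    IsMap S T f where
  inj_edgelet : ∀ a b : S.V, S.graph.Adj a b → f a ≠ f b
  two_gates : ∀ x : S.V, 2 ≤ (f '' S.graph.neighborSet x).encard
  three_gates : ∀ x : S.V, S.IsNatural x → 3 ≤ (f '' S.graph.neighborSet x).encard

/-- The generating relation of the equivariant identification of the initial segments with `n`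
edgelets of two oriented natural edges `η`, `η'`. -/
def FoldRel (S : FreeSplitting.{u, v} F) (η η' : List S.V) (n : ℕ) (x y : S.V) : Prop :=
  ∃ (g : F) (k : ℕ), k ≤ n ∧ η[k]? = some (g • x) ∧ η'[k]? = some (g • y)

/-- `h : S → U` is a maximal fold factor of the composition of `h` and `g : U → T`: for some
distinct oriented natural edges `η`, `η'` of `S` with a common initial vertex, `h` is a foldable
map which is the quotient map by the equivariant identification of the initial segments of `η`
and `η'` with `n ≥ 1` edgelets, and these are the maximal initial segments on which `g ∘ h`
agrees. -/
def IsMaxFoldFactor (S U T : FreeSplitting.{u, v} F) (h : S.V → U.V) (g : U.V → T.V) : Prop :=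
  IsFoldable S U h ∧ ∃ (η η' : List S.V) (n : ℕ),
    S.IsNaturalEdge η ∧ S.IsNaturalEdge η' ∧ η ≠ η' ∧ η.head? = η'.head? ∧
    1 ≤ n ∧ n < η.length ∧ n < η'.length ∧
    (∀ x y : S.V, h x = h y ↔ Relation.EqvGen (S.FoldRel η η' n) x y) ∧
    ∀ m : ℕ, m < η.length → m < η'.length →
      ((η.take (m + 1)).map (fun x => g (h x)) = (η'.take (m + 1)).map (fun x => g (h x)) ↔
        m ≤ n)

/-! ### Invariant subgraphs and complexity -/

/-- An `F`-invariant subgraph without degenerate components, given by its set of edgelets. -/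
structure InvSubgraph (T : FreeSplitting.{u, v} F) where
  graph : SimpleGraph T.V
  le : graph ≤ T.graph
  smul_adj : ∀ (g : F) (a b : T.V), graph.Adj a b → graph.Adj (g • a) (g • b)

namespace InvSubgraph

variable {T : FreeSplitting.{u, v} F}

/-- A natural subgraph: it contains a natural edge as soon as it contains one of its edgelets. -/
def IsNaturalSubgraph (β : T.InvSubgraph) : Prop :=
  ∀ p : List T.V, T.IsNaturalEdge p → ∀ a b c d : T.V, [a, b] <:+: p → [c, d] <:+: p →
    β.graph.Adj a b → β.graph.Adj c d

theorem reachable_smul (β : T.InvSubgraph) (g : F) {a b : T.V} (h : β.graph.Reachable a b) :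
    β.graph.Reachable (g • a) (g • b) :=
  h.map (⟨fun x => g • x, fun {a b} hab => β.smul_adj g a b hab⟩ : β.graph →g β.graph)

/-- The vertices of `β`. -/
def Vert (β : T.InvSubgraph) : Type v := {x : T.V // ∃ y, β.graph.Adj x y}

/-- Two vertices of `β` are equivalent if their components are in the same `F`-orbit. -/
def orbitSetoid (β : T.InvSubgraph) : Setoid β.Vert where
  r x y := ∃ g : F, β.graph.Reachable (g • x.1) y.1
  iseqv := by
    refine ⟨fun x => ⟨1, by rw [one_smul]⟩, ?_, ?_⟩
    · rintro x y ⟨g, h⟩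
      refine ⟨g⁻¹, ?_⟩
      have := β.reachable_smul g⁻¹ h
      rw [inv_smul_smul] at this
      exact this.symm
    · rintro x y z ⟨g, h⟩ ⟨g', h'⟩
      refine ⟨g' * g, ?_⟩
      rw [mul_smul]
      exact (β.reachable_smul g' h).trans h'

/-- The set of `F`-orbits of components of `β`. -/
def CompOrbit (β : T.InvSubgraph) : Type v := Quotient β.orbitSetoid

/-- The stabilizer of the component of `β` containing `x`. -/
def compStab (β : T.InvSubgraph) (x : T.V) : Subgroup F where
  carrier := {g | β.graph.Reachable (g • x) x}
  one_mem' := by simp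
  mul_mem' := by
    intro a b (ha : β.graph.Reachable (a • x) x) (hb : β.graph.Reachable (b • x) x)
    change β.graph.Reachable ((a * b) • x) x
    rw [mul_smul]
    exact (β.reachable_smul a hb).trans ha
  inv_mem' := by
    intro a (ha : β.graph.Reachable (a • x) x)
    change β.graph.Reachable (a⁻¹ • x) x
    have := β.reachable_smul a⁻¹ ha
    rw [inv_smul_smul] at this
    exact this.symm

/-- The complexity `C₁ + (rank F - C₂)`, where `C₁` is the number of orbits of components of `β`
and `C₂` is the sum of the ranks of the stabilizers of one component from each orbit. -/
def complexity [IsFreeGroup F] (β : T.InvSubgraph) : ℤ :=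
  (Nat.card β.CompOrbit : ℤ) +
    ((freeRank F : ℤ) - ∑ᶠ q : β.CompOrbit, (freeRank (β.compStab (Quotient.out q).1) : ℤ))

end InvSubgraph

/-! ### Geometric realization and conjugacies -/

/-- The points of the tree, in barycentric coordinates. -/
def Pt (T : FreeSplitting.{u, v} F) : Type v :=
  {x : T.V →₀ ℝ // ∃ (a b : T.V) (t : ℝ), (a = b ∨ T.graph.Adj a b) ∧ 0 ≤ t ∧ t ≤ 1 ∧
    x = Finsupp.single a (1 - t) + Finsupp.single b t}

/-- The parametrization of an edgelet by the unit interval. -/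
def edgePt (T : FreeSplitting.{u, v} F) (e : {p : T.V × T.V // T.graph.Adj p.1 p.2})
    (t : unitInterval) : T.Pt :=
  ⟨Finsupp.single e.1.1 (1 - (t : ℝ)) + Finsupp.single e.1.2 (t : ℝ),
    e.1.1, e.1.2, t, Or.inr e.2, t.2.1, t.2.2, rfl⟩

/-- The CW topology: the finest topology for which all edgelet parametrizations are
continuous. -/
instance (T : FreeSplitting.{u, v} F) : TopologicalSpace T.Pt :=
  ⨆ e, TopologicalSpace.coinduced (T.edgePt e) inferInstance

/-- The map of geometric realizations (affine on edgelets) induced by a simplicial map. -/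
def Pt.map {S T : FreeSplitting.{u, v} F} (f : S.V → T.V)
    (hf : ∀ a b : S.V, S.graph.Adj a b → f a = f b ∨ T.graph.Adj (f a) (f b)) (x : S.Pt) : T.Pt :=
  ⟨Finsupp.mapDomain f x.1, by
    obtain ⟨a, b, t, hab, h0, h1, hx⟩ := x.2
    refine ⟨f a, f b, t, ?_, h0, h1, ?_⟩
    · rcases hab with h | h
      · exact Or.inl (by rw [h])
      · exact hf a b h
    · rw [hx, Finsupp.mapDomain_add, Finsupp.mapDomain_single, Finsupp.mapDomain_single]⟩

/-- The map of geometric realizations induced by a map of free splittings. -/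
def Hom.onPt {S T : FreeSplitting.{u, v} F} (f : Hom S T) : S.Pt → T.Pt :=
  Pt.map f.toFun f.isMap.simplicial

/-- The action of `F` on the points of the tree. -/
def smulPt (T : FreeSplitting.{u, v} F) (g : F) : T.Pt → T.Pt :=
  Pt.map (fun x => g • x) (fun a b h => Or.inr (T.smul_adj g a b h))

/-- A (not necessarily simplicial) conjugacy: an equivariant homeomorphism of trees. -/
structure IsConjugacy (S T : FreeSplitting.{u, v} F) (φ : S.Pt → T.Pt) : Prop where
  homeo : IsHomeomorph φ
  equivariant : ∀ (g : F) (x : S.Pt), φ (S.smulPt g x) = T.smulPt g (φ x)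

end FreeSplitting

/-- A sequence of free splittings and maps `T₀ → T₁ → T₂ → ⋯`. Finite sequences `Tᵢ → ⋯ → Tⱼ` are
treated as segments of infinite ones: all predicates below involve only the terms whose indices
lie in an interval `[i, j]`, and any finite sequence extends by constant sequences with identity
maps at both ends. -/
structure SplittingSeq (F : Type u) [Group F] where
  obj : ℕ → FreeSplitting.{u, v} F
  map : ∀ k, FreeSplitting.Hom (obj k) (obj (k + 1))

namespace SplittingSeq

open FreeSplitting

variable {F : Type u} [Group F]

/-- The composed map from the `i`-th to the `j`-th term. -/
def trans (T : SplittingSeq.{u, v} F) (i j : ℕ) (h : i ≤ j) : Hom (T.obj i) (T.obj j) :=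
  Nat.leRec (motive := fun j _ => Hom (T.obj i) (T.obj j)) (Hom.id (T.obj i))
    (fun k _ f => (T.map k).comp f) h

theorem trans_self (T : SplittingSeq.{u, v} F) (i : ℕ) :
    T.trans i i le_rfl = Hom.id (T.obj i) :=
  Nat.leRec_self _ _

theorem trans_succ (T : SplittingSeq.{u, v} F) (i j : ℕ) (h : i ≤ j) :
    T.trans i (j + 1) (Nat.le_succ_of_le h) = (T.map j).comp (T.trans i j h) :=
  Nat.leRec_succ _ _ _

/-- `Tᵢ → ⋯ → Tⱼ` is a foldable sequence. -/
def IsFoldableSeq (T : SplittingSeq.{u, v} F) (i j : ℕ) : Prop :=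
  ∀ (k : ℕ) (_ : i ≤ k) (h : k ≤ j), IsFoldable (T.obj k) (T.obj j) (T.trans k j h).toFun

/-- `Tᵢ → ⋯ → Tⱼ` is a fold sequence. -/
structure IsFoldSeq (T : SplittingSeq.{u, v} F) (i j : ℕ) : Prop where
  foldable : ∀ h : i ≤ j, IsFoldable (T.obj i) (T.obj j) (T.trans i j h).toFun
  maxFold : ∀ (k : ℕ) (_ : i ≤ k) (h : k + 1 ≤ j),
    IsMaxFoldFactor (T.obj k) (T.obj (k + 1)) (T.obj j) (T.map k).toFun
      (T.trans (k + 1) j h).toFun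

/-- The vertical maps `π k : S k → T k`, `i ≤ k ≤ j`, form a combing rectangle with top row
`Sᵢ → ⋯ → Sⱼ` and bottom row `Tᵢ → ⋯ → Tⱼ`. -/
structure IsCombingRectangle (S T : SplittingSeq.{u, v} F)
    (π : ∀ k, (S.obj k).V → (T.obj k).V) (i j : ℕ) : Prop where
  foldable : S.IsFoldableSeq i j
  collapse : ∀ k, i ≤ k → k ≤ j → IsCollapse (S.obj k) (T.obj k) (π k)
  comm : ∀ k, i ≤ k → k < j → ∀ x : (S.obj k).V,
    π (k + 1) ((S.map k).toFun x) = (T.map k).toFun (π k x)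
  /-- the collapsed subgraph of `π k` is the preimage of the collapsed subgraph of
  `π (k + 1)` -/
  preimage : ∀ k, i ≤ k → k < j → ∀ a b : (S.obj k).V, (S.obj k).graph.Adj a b →
    (π k a = π k b ↔ π (k + 1) ((S.map k).toFun a) = π (k + 1) ((S.map k).toFun b))

/-- `β k ∪ ρ k` (`i ≤ k ≤ j`) is an invariant natural blue-red decomposition of
`Tᵢ → ⋯ → Tⱼ`. -/
structure IsNaturalBlueRed (T : SplittingSeq.{u, v} F) (i j : ℕ)
    (β ρ : ∀ k, (T.obj k).InvSubgraph) : Prop where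
  union : ∀ k, i ≤ k → k ≤ j → (β k).graph ⊔ (ρ k).graph = (T.obj k).graph
  disjoint : ∀ k, i ≤ k → k ≤ j → (β k).graph ⊓ (ρ k).graph = ⊥
  blue_nonempty : ∀ k, i ≤ k → k ≤ j → (β k).graph ≠ ⊥
  red_nonempty : ∀ k, i ≤ k → k ≤ j → (ρ k).graph ≠ ⊥
  blue_natural : ∀ k, i ≤ k → k ≤ j → (β k).IsNaturalSubgraph
  red_natural : ∀ k, i ≤ k → k ≤ j → (ρ k).IsNaturalSubgraph
  blue_preimage : ∀ (a b : ℕ) (_ : i ≤ a) (h : a ≤ b) (_ : b ≤ j) (x y : (T.obj a).V),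
    (T.obj a).graph.Adj x y → ((β a).graph.Adj x y ↔
      (β b).graph.Adj ((T.trans a b h).toFun x) ((T.trans a b h).toFun y))
  red_preimage : ∀ (a b : ℕ) (_ : i ≤ a) (h : a ≤ b) (_ : b ≤ j) (x y : (T.obj a).V),
    (T.obj a).graph.Adj x y → ((ρ a).graph.Adj x y ↔
      (ρ b).graph.Adj ((T.trans a b h).toFun x) ((T.trans a b h).toFun y))

/-- The natural edges `e k` (`i ≤ k ≤ j`) form an almost invariant edge of the foldable sequence
`Tᵢ → ⋯ → Tⱼ`: for `a < b`, there is a unique arc `q` of `T a` which the foldable map `T a → T b`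
takes isomorphically to `e b`, and `e a` is the natural edge containing `q`. -/
structure IsAlmostInvariantEdge (T : SplittingSeq.{u, v} F) (i j : ℕ)
    (e : ∀ k, List (T.obj k).V) : Prop where
  natural : ∀ k, i ≤ k → k ≤ j → (T.obj k).IsNaturalEdge (e k)
  almost : ∀ (a b : ℕ) (_ : i ≤ a) (h : a < b) (_ : b ≤ j),
    ∃ q : List (T.obj a).V, q <:+: e a ∧ ∀ q' : List (T.obj a).V,
      (q'.IsChain (T.obj a).graph.Adj ∧ q'.map (T.trans a b h.le).toFun = e b) ↔ q' = q

variable [IsFreeGroup F]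

/-- `Sᵢ`, `Sⱼ` differ by less than one free splitting unit (`i < j`). -/
def LtOneUnit (S : SplittingSeq.{u, v} F) (i j : ℕ) : Prop :=
  ∃ (S' T : SplittingSeq.{u, v} F) (σ : ∀ k, (S.obj k).V → (S'.obj k).V)
    (τ : ∀ k, (T.obj k).V → (S'.obj k).V),
    IsCombingRectangle S S' σ i j ∧ IsCombingRectangle T S' τ i j ∧
    ((∃ β ρ : ∀ k, (T.obj k).InvSubgraph, T.IsNaturalBlueRed i j β ρ ∧
        ∀ k, i ≤ k → k ≤ j → (β k).complexity = (β i).complexity) ∨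
      ∃ e : ∀ k, List (T.obj k).V, T.IsAlmostInvariantEdge i j e)

/-- The number of free splitting units between `S_I` and `S_J` (`I ≤ J`): the maximal `n` for
which there is a sequence `I ≤ i 0 < ⋯ < i n ≤ J` whose consecutive terms differ by at least one
free splitting unit. -/
def numUnits (S : SplittingSeq.{u, v} F) (I J : ℕ) : ℕ :=
  sSup {n : ℕ | ∃ i : Fin (n + 1) → ℕ, StrictMono i ∧ I ≤ i 0 ∧ i (Fin.last n) ≤ J ∧
    ∀ l : Fin n, ¬ S.LtOneUnit (i l.castSucc) (i l.succ)}

end SplittingSeq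

end

/-! Collapsing the intersection of the two collapse graphs in the peak row gives a row `T` in which
the blue graph (collapsed towards T^3) and the red graph (collapsed towards T^1) are complementary
in every column (`exists_normalization`). Either the blue graph in column I contains both or none of
the edgelets at each vertex of valence two, or some such vertex x has a blue edgelet xy and a red
edgelet xz.

The first case contradicts the lower bound on free splitting units
(`numUnits_lt_of_isLocallyNatural`). Foldable maps are local isomorphisms over vertices of valence
two, so naturality spreads from column I to all columns up to J. Blue complexity does not increase
along the row and lies between 1 and 3 rank - 2. Two columns of equal complexity differ by less than
one unit through alternative (a), so there are fewer than 3 rank - 2 units, hence fewer than 4 rank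
- 3.

These facts about complexity are linear algebra over ℚ. The rank of a free group is the dimension of
its space of homomorphisms to ℚ, and the complexity of a nonempty subgraph is the dimension of the
space of functions on its components that are equivariant for some action by translations
(`finrank_quasiInv_comp`). Maps onto the components of another subgraph pull such functions back
injectively, which gives monotonicity; constant functions give positivity; an Euler characteristic
count of natural vertices (`card_natural_add_two_le`) gives the upper bound.

In the second case, collapse everything except the orbit of xy, pulling back to the columns before
I. The edgelet xy survives in T^1, so the result is a collapse of the T^1 row (`exists_factor`).
Likewise, keeping only the orbit of xz gives a collapse of the T^3 row. Vertices over x have valence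
two in every earlier column, so sliding across them exchanges the edgelets over xy with those over
xz and identifies the two collapsed rows (`exists_common_collapse`). A single row U thus serves both
sides, with identity conjugacies. Its foldability is an instance of `IsFoldable.of_collapse`. -/

noncomputable section

/-! ### Trees -/

namespace SimpleGraph

variable {V : Type v} {G : SimpleGraph V}

/-- The vertices which are closer to `q` than to `p`. If `p q` is an edge of a tree, this is the
component of `q` in the complement of the interior of that edge. -/
def side (G : SimpleGraph V) (p q : V) : Set V := {z | G.dist z q < G.dist z p}

theorem Reachable.exists_adj_boundary {u w : V} (h : G.Reachable u w) {A : Set V} (hu : u ∈ A)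
    (hw : w ∉ A) : ∃ x y, G.Adj x y ∧ x ∈ A ∧ y ∉ A := by
  obtain ⟨p⟩ := h
  obtain ⟨d, -, h1, h2⟩ := p.exists_boundary_dart A hu hw
  exact ⟨d.fst, d.snd, d.adj, h1, h2⟩

theorem Reachable.mem_of_closed {u w : V} (h : G.Reachable u w) {A : Set V} (hu : u ∈ A)
    (hA : ∀ x y, G.Adj x y → x ∈ A → y ∈ A) : w ∈ A := by
  by_contra hw
  obtain ⟨x, y, hxy, hx, hy⟩ := h.exists_adj_boundary hu hw
  exact hy (hA x y hxy hx)

/-- A cut crossed by a single edge makes that edge a bridge. -/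
theorem isAcyclic_of_cuts (h : ∀ x y, G.Adj x y → ∃ A : Set V, x ∈ A ∧ y ∉ A ∧
    ∀ u ∈ A, ∀ w, w ∉ A → G.Adj u w → u = x ∧ w = y) : G.IsAcyclic := by
  rw [isAcyclic_iff_forall_adj_isBridge]
  intro x y hxy
  obtain ⟨A, hx, hy, hA⟩ := h x y hxy
  rw [isBridge_iff]
  intro hr
  obtain ⟨u, w, huw, hu, hw⟩ := hr.exists_adj_boundary hx hy
  simp only [deleteEdges_adj, Set.mem_singleton_iff] at huw
  obtain ⟨rfl, rfl⟩ := hA u hu w hw huw.1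
  exact huw.2 rfl

theorem Connected.exists_adj_dist_lt (hG : G.Connected) {p z : V} (h : p ≠ z) :
    ∃ q, G.Adj p q ∧ z ∈ G.side p q := by
  obtain ⟨w, hw⟩ := hG.exists_walk_length_eq_dist p z
  cases w with
  | nil => exact absurd rfl h
  | @cons _ q _ hpq w =>
    refine ⟨q, hpq, ?_⟩
    have h1 := dist_le w
    rw [Walk.length_cons] at hw
    change G.dist z q < G.dist z p
    rw [dist_comm, G.dist_comm (u := z)]
    omega

theorem mem_side_self {p q : V} (h : G.Adj p q) : q ∈ G.side p q := by
  change G.dist q q < G.dist q p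
  rw [dist_self, dist_eq_one_iff_adj.2 h.symm]
  exact one_pos

theorem not_mem_side_self (p q : V) : p ∉ G.side p q := by
  simp [side]

namespace IsTree

variable (hG : G.IsTree)
include hG

theorem mem_side_or {p q : V} (h : G.Adj p q) (z : V) : z ∈ G.side p q ∨ z ∈ G.side q p := by
  have := hG.dist_eq_dist_add_one_of_adj z h
  simp only [side, Set.mem_ofPred_eq]
  omega

theorem dist_of_mem_side {p q z : V} (h : G.Adj p q) (hz : z ∈ G.side p q) :
    G.dist z p = G.dist z q + 1 := by
  have := hG.dist_eq_dist_add_one_of_adj z h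
  simp only [side, Set.mem_ofPred_eq] at hz
  omega

/-- Both neighbors are the penultimate vertex of the unique path from z to p. -/
theorem eq_of_mem_side {p q₁ q₂ z : V} (h₁ : G.Adj p q₁) (h₂ : G.Adj p q₂)
    (hz₁ : z ∈ G.side p q₁) (hz₂ : z ∈ G.side p q₂) : q₁ = q₂ := by
  obtain ⟨w₁, hw₁⟩ := hG.connected.exists_walk_length_eq_dist z q₁
  obtain ⟨w₂, hw₂⟩ := hG.connected.exists_walk_length_eq_dist z q₂
  have e₁ := hG.dist_of_mem_side h₁ hz₁
  have e₂ := hG.dist_of_mem_side h₂ hz₂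
  have p₁ : (w₁.concat h₁.symm).IsPath :=
    Walk.isPath_of_length_eq_dist _ (by rw [Walk.length_concat, hw₁, e₁])
  have p₂ : (w₂.concat h₂.symm).IsPath :=
    Walk.isPath_of_length_eq_dist _ (by rw [Walk.length_concat, hw₂, e₂])
  have := congrArg Walk.penultimate ((hG.existsUnique_path z p).unique p₁ p₂)
  simpa using this

theorem side_subset_side {p q r : V} (h₁ : G.Adj p q) (h₂ : G.Adj q r) (h : r ≠ p) :
    G.side q r ⊆ G.side p q := by
  intro z hz
  rcases hG.mem_side_or h₁ z with h' | h'
  · exact h'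
  · exact absurd (hG.eq_of_mem_side h₂ h₁.symm hz h') h

/-- The edge p q is the only one between its two sides. Comparing distances shows that w is as far
from q as u is from p; if this distance were positive, u would be the next vertex from w towards q,
against its lying on the side of p. -/
theorem eq_of_adj_side {p q u w : V} (h : G.Adj p q) (hu : u ∉ G.side p q) (hw : w ∈ G.side p q)
    (huw : G.Adj u w) : u = p ∧ w = q := by
  have hu' := (hG.mem_side_or h u).resolve_left hu
  have e1 := hG.dist_of_mem_side h hw
  have e2 := hG.dist_of_mem_side h.symm hu'
  have c1 := hG.dist_eq_dist_add_one_of_adj q huw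
  have c2 := hG.dist_eq_dist_add_one_of_adj p huw
  simp only [G.dist_comm (u := q), G.dist_comm (u := p)] at c1 c2
  have e3 : G.dist w q = G.dist u p := by omega
  by_cases hwq : w = q
  · refine ⟨?_, hwq⟩
    rw [hwq, dist_self] at e3
    exact hG.connected.dist_eq_zero_iff.1 e3.symm
  · exfalso
    obtain ⟨w', hw', hq⟩ := hG.connected.exists_adj_dist_lt hwq
    have e4 := hG.dist_of_mem_side hw' hq
    have c3 := hG.dist_eq_dist_add_one_of_adj w' h
    have c4 := hG.dist_eq_dist_add_one_of_adj p hw'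
    simp only [G.dist_comm (u := q), G.dist_comm (u := p)] at e4 c4
    have : w' = u := by
      refine hG.eq_of_mem_side (z := p) hw' huw.symm ?_ ?_ <;>
      simp only [side, Set.mem_ofPred_eq, G.dist_comm (u := p)] <;> omega
    subst this
    omega

theorem not_mem_side_of_reachable {H : SimpleGraph V} (hH : H ≤ G) {p q x y : V} (h : G.Adj p q)
    (hpq : ¬ H.Adj p q) (hx : x ∉ G.side p q) (hxy : H.Reachable x y) : y ∉ G.side p q := by
  intro hy
  obtain ⟨u, w, huw, hu, hw⟩ := hxy.exists_adj_boundary (A := (G.side p q)ᶜ) hx (by simpa using hy)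
  obtain ⟨rfl, rfl⟩ := hG.eq_of_adj_side h hu (by simpa using hw) (hH huw)
  exact hpq huw

/-- A connected spanning subgraph of a tree is the whole tree. -/
theorem le_of_connected {H : SimpleGraph V} (hH : H ≤ G) (hc : ∀ x y, H.Reachable x y) : G ≤ H := by
  intro p q h
  by_contra hpq
  exact hG.not_mem_side_of_reachable hH h hpq (not_mem_side_self p q) (hc p q) (mem_side_self h)

/-- An antisymmetric function on the oriented edges of a tree has a potential. -/
theorem exists_potential {A : Type*} [AddCommGroup A] (b : V → V → A)
    (hb : ∀ x y, G.Adj x y → b y x = - b x y) :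
    ∃ u : V → A, ∀ x y, G.Adj x y → u y = u x + b x y := by
  -- The potential at x is the sum of b along the geodesic from x₀ to x.
  obtain ⟨x₀⟩ := hG.connected.nonempty
  choose P hP using hG.connected.exists_walk_length_eq_dist x₀
  let S : ∀ {x y : V}, G.Walk x y → A := fun w => (w.darts.map fun d => b d.fst d.snd).sum
  have key : ∀ x y, G.Adj x y → G.dist x₀ y = G.dist x₀ x + 1 → S (P y) = S (P x) + b x y := by
    intro x y hxy hd
    have h1 : ((P x).concat hxy).IsPath :=
      Walk.isPath_of_length_eq_dist _ (by rw [Walk.length_concat, hP, hd])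
    have h2 : (P y).IsPath := Walk.isPath_of_length_eq_dist _ (hP y)
    rw [(hG.existsUnique_path x₀ y).unique h2 h1]
    simp [S, Walk.darts_concat]
  refine ⟨fun x => S (P x), fun x y hxy => ?_⟩
  rcases hG.dist_eq_dist_add_one_of_adj x₀ hxy with h | h
  · change S (P y) = S (P x) + b x y
    rw [key y x hxy.symm h, hb x y hxy]
    abel
  · exact key x y hxy h

/-- In a connected set which is left by three edges with distinct endpoints outside of it, there
is a vertex with three neighbors. -/
theorem exists_three_adj {C : Set V} (hC : ∀ m ∈ C, ∀ n, n ∉ C → G.Adj m n → ∀ c ∈ C, c ∉ G.side m n)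
    {c e : Fin 3 → V} (hc : ∀ i, c i ∈ C) (he : ∀ i, e i ∉ C) (hce : ∀ i, G.Adj (c i) (e i))
    (hinj : Function.Injective e) :
    ∃ m ∈ C, ∃ n : Fin 3 → V, Function.Injective n ∧ ∀ i, G.Adj m (n i) := by
  -- The branch vertex is a median: it minimizes over C the sum of the distances to the three
  -- outside endpoints. If two of them lay in the same direction, a step that way inside C would
  -- lower the sum, and a step leaving C would force the two endpoints to coincide.
  let D : V → ℕ := fun z => ∑ i, G.dist (e i) z
  have hne : (D '' C).Nonempty := ⟨_, c 0, hc 0, rfl⟩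
  obtain ⟨m, hm, hmin⟩ := Nat.sInf_mem hne
  have hle : ∀ z ∈ C, D m ≤ D z := fun z hz => hmin ▸ Nat.sInf_le ⟨z, hz, rfl⟩
  have hme : ∀ i, m ≠ e i := fun i h => he i (h ▸ hm)
  choose n hn hns using fun i => hG.connected.exists_adj_dist_lt (hme i)
  refine ⟨m, hm, n, fun i j hij => ?_, hn⟩
  by_contra hne
  by_cases hnC : n i ∈ C
  · have h1 := hG.dist_of_mem_side (hn i) (hns i)
    have h2 := hG.dist_of_mem_side (hn j) (hns j)
    rw [← hij] at h2
    have h3 : ∀ k, G.dist (e k) (n i) ≤ G.dist (e k) m + 1 := fun k => by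
      have := hG.dist_eq_dist_add_one_of_adj (e k) (hn i)
      omega
    have h4 := hle _ hnC
    simp only [D, Fin.sum_univ_three] at h4
    have h30 := h3 0
    have h31 := h3 1
    have h32 := h3 2
    generalize n i = ν at h1 h2 h30 h31 h32 h4
    clear_value D
    fin_cases i <;> fin_cases j <;> first | exact absurd rfl hne | (dsimp at h1 h2; omega)
  · have key : ∀ k, e k ∈ G.side m (n i) → e k = n i := fun k hk =>
      (hG.eq_of_adj_side (hn i) (hC m hm _ hnC (hn i) _ (hc k)) hk (hce k)).2
    have hj := hns j
    rw [← hij] at hj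
    exact hne (hinj ((key i (hns i)).trans (key j hj).symm))

end IsTree

end SimpleGraph

namespace FreeSplitting

open SimpleGraph

variable {F : Type u} [Group F]

/-! ### Maps and collapse maps -/

section basic

variable (T : FreeSplitting.{u, v} F)

theorem smul_adj_iff (g : F) {a b : T.V} : T.graph.Adj (g • a) (g • b) ↔ T.graph.Adj a b := by
  refine ⟨fun h => ?_, T.smul_adj g a b⟩
  simpa using T.smul_adj g⁻¹ _ _ h

theorem exists_adj (x : T.V) : ∃ y, T.graph.Adj x y := by
  have := T.nontrivial
  obtain ⟨z, hz⟩ := exists_ne x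
  obtain ⟨y, hy, -⟩ := T.isTree.connected.exists_adj_dist_lt hz.symm
  exact ⟨y, hy⟩

theorem eq_one_of_fix {g : F} {a b : T.V} (h : T.graph.Adj a b) (ha : g • a = a)
    (hb : g • b = b) : g = 1 :=
  T.edge_stab g a b h (by rw [ha, hb])

theorem eq_one_of_swap {g : F} {a b : T.V} (h : T.graph.Adj a b) (ha : g • a = b)
    (hb : g • b = a) : g = 1 :=
  T.edge_stab g a b h (by rw [ha, hb, Sym2.eq_swap])

theorem neighborSet_smul (g : F) (x : T.V) :
    T.graph.neighborSet (g • x) = (fun y => g • y) '' T.graph.neighborSet x := by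
  ext y
  simp only [mem_neighborSet, Set.mem_image]
  constructor
  · intro h
    refine ⟨g⁻¹ • y, ?_, smul_inv_smul g y⟩
    rw [← T.smul_adj_iff g, smul_inv_smul]
    exact h
  · rintro ⟨z, hz, rfl⟩
    exact T.smul_adj g _ _ hz

theorem isNatural_smul_iff (g : F) (x : T.V) : T.IsNatural (g • x) ↔ T.IsNatural x := by
  rw [IsNatural, IsNatural, neighborSet_smul, (MulAction.injective g).encard_image]

/-- A nonempty invariant set of vertices in which any two vertices are joined by a chain of
edges contains all vertices. -/
theorem eq_univ_of_reachable {s : Set T.V} (hs : s.Nonempty) (hinv : ∀ (g : F), ∀ x ∈ s, g • x ∈ s)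
    (H : SimpleGraph T.V) (hH : H ≤ T.graph) (hHs : ∀ x y, H.Adj x y → x ∈ s → y ∈ s)
    (hr : ∀ x ∈ s, ∀ y ∈ s, H.Reachable x y) : s = Set.univ := by
  refine T.minimal s hs hinv ?_
  have := hs.to_subtype
  refine ⟨?_⟩
  rintro ⟨x, hx⟩ ⟨y, hy⟩
  obtain ⟨hy', h⟩ := (hr x hx y hy).mem_of_closed
    (A := {z | ∃ hz : z ∈ s, (T.graph.induce s).Reachable ⟨x, hx⟩ ⟨z, hz⟩}) ⟨hx, Reachable.refl _⟩
    (by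
      rintro z w hzw ⟨hz, hr⟩
      refine ⟨hHs z w hzw hz, hr.trans (Adj.reachable ?_)⟩
      exact hH hzw)
  exact h

end basic

variable {S T U : FreeSplitting.{u, v} F}

/-- The image is a nonempty invariant connected set of vertices, so minimality of the target
applies. -/
theorem IsMap.surjective {f : S.V → T.V} (hf : IsMap S T f) : Function.Surjective f := by
  rw [← Set.range_eq_univ]
  obtain ⟨x₀⟩ := S.isTree.connected.nonempty
  refine T.eq_univ_of_reachable ⟨f x₀, x₀, rfl⟩ ?_
    (SimpleGraph.fromRel fun a b => T.graph.Adj a b ∧ a ∈ Set.range f ∧ b ∈ Set.range f) ?_ ?_ ?_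
  · rintro g _ ⟨x, rfl⟩
    exact ⟨g • x, hf.equivariant g x⟩
  · rintro a b ⟨-, h | h⟩
    · exact h.1
    · exact h.1.symm
  · rintro a b ⟨-, h | h⟩ -
    · exact h.2.2
    · exact h.2.1
  · rintro _ ⟨x, rfl⟩ _ ⟨y, rfl⟩
    refine (S.isTree.connected x y).mem_of_closed (A := {z | Reachable _ (f x) (f z)})
      (Reachable.refl _) ?_
    intro z w hzw hz
    rcases hf.simplicial z w hzw with h | h
    · change Reachable _ _ (f w)
      rw [← h]
      exact hz
    · exact Reachable.trans hz (Adj.reachable ⟨h.ne, Or.inl ⟨h, ⟨z, rfl⟩, ⟨w, rfl⟩⟩⟩)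

theorem IsMap.adj_of_ne {f : S.V → T.V} (hf : IsMap S T f) {a b : S.V} (h : S.graph.Adj a b)
    (hne : f a ≠ f b) : T.graph.Adj (f a) (f b) :=
  (hf.simplicial a b h).resolve_left hne

/-- A path between preimages of a and b must cross from one side of the edgelet to the other, and
only a lift of the edgelet itself can do so. -/
theorem IsMap.exists_lift {f : S.V → T.V} (hf : IsMap S T f) {a b : T.V} (h : T.graph.Adj a b) :
    ∃ x y, S.graph.Adj x y ∧ f x = a ∧ f y = b := by
  obtain ⟨x, hx⟩ := hf.surjective a
  obtain ⟨y, hy⟩ := hf.surjective b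
  obtain ⟨z, w, hzw, hz, hw⟩ := (S.isTree.connected x y).exists_adj_boundary
    (A := {z | f z ∉ T.graph.side a b}) (by
      change f x ∉ _
      rw [hx]
      exact not_mem_side_self a b) (by
      simpa [hy] using mem_side_self h)
  have hw' : f w ∈ T.graph.side a b := by simpa using hw
  have hne : f z ≠ f w := fun e => hz (e ▸ hw')
  obtain ⟨h1, h2⟩ := T.isTree.eq_of_adj_side h hz hw' (hf.adj_of_ne hzw hne)
  exact ⟨z, w, hzw, h1, h2⟩

theorem IsMap.id (S : FreeSplitting.{u, v} F) : IsMap S S (fun x => x) :=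
  (Hom.id S).isMap

theorem IsMap.comp {g : T.V → U.V} {f : S.V → T.V} (hg : IsMap T U g) (hf : IsMap S T f) :
    IsMap S U (fun x => g (f x)) :=
  (Hom.comp ⟨g, hg⟩ ⟨f, hf⟩).isMap

theorem IsCollapse.comp {g : T.V → U.V} {f : S.V → T.V} (hg : IsCollapse T U g)
    (hf : IsCollapse S T f) : IsCollapse S U (fun x => g (f x)) where
  toIsMap := hg.toIsMap.comp hf.toIsMap
  inj_over a b c d hab hcd hne h1 h2 := by
    have hab' := hf.toIsMap.adj_of_ne hab (fun e => hne (by rw [e]))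
    have hcd' := hf.toIsMap.adj_of_ne hcd (fun e => hne (by rw [h1, h2, e]))
    obtain ⟨e1, e2⟩ := hg.inj_over _ _ _ _ hab' hcd' hne h1 h2
    exact hf.inj_over _ _ _ _ hab hcd hab'.ne e1 e2

/-- The collapse graph of a map. -/
def collapseGraph (S : FreeSplitting.{u, v} F) {X : Type*} (f : S.V → X) : S.InvSubgraph where
  graph :=
    -- Requiring the equality on all translates makes the subgraph invariant even when the codomain
    -- of `f` carries no action, as for a pair of collapse maps.
    { Adj := fun a b => S.graph.Adj a b ∧ ∀ g : F, f (g • a) = f (g • b)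
      symm := ⟨fun _ _ h => ⟨h.1.symm, fun g => (h.2 g).symm⟩⟩
      loopless := ⟨fun _ h => h.1.ne rfl⟩ }
  le := fun _ _ h => h.1
  smul_adj := fun g a b h => ⟨S.smul_adj g a b h.1, fun g' => by
    rw [← mul_smul, ← mul_smul]; exact h.2 _⟩

theorem IsMap.collapseGraph_adj {f : S.V → T.V} (hf : IsMap S T f) {a b : S.V} :
    (S.collapseGraph f).graph.Adj a b ↔ S.graph.Adj a b ∧ f a = f b := by
  refine ⟨fun h => ⟨h.1, by simpa using h.2 1⟩, fun h => ⟨h.1, fun g => ?_⟩⟩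
  rw [hf.equivariant, hf.equivariant, h.2]

/-- The fibers of a collapse map are connected. -/
theorem IsCollapse.reachable {f : S.V → T.V} (hf : IsCollapse S T f) {x y : S.V} (h : f x = f y) :
    (S.collapseGraph f).graph.Reachable x y := by
  have key : ∀ (n : ℕ) (x y : S.V) (w : S.graph.Walk x y), w.length = n → f x = f y →
      (S.collapseGraph f).graph.Reachable x y := by
    intro n
    induction n using Nat.strong_induction_on with
    | _ n ih =>
      intro x y w hw hxy
      cases w with
      | nil => exact Reachable.refl _
      | @cons _ x₁ _ hx w =>
        classical
        rw [Walk.length_cons] at hw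
        by_cases hc : f x = f x₁
        · exact (Adj.reachable (hf.toIsMap.collapseGraph_adj.2 ⟨hx, hc⟩)).trans
            (ih w.length (by omega) _ _ w rfl (hc ▸ hxy))
        -- The image leaves f x through an edgelet and must return through it. Injectivity over that
        -- edgelet makes the walk revisit x, so the loop can be cut off.
        · have hadj := hf.toIsMap.adj_of_ne hx hc
          have hx₁ : f x₁ ∈ T.graph.side (f x) (f x₁) := mem_side_self hadj
          have hy : f y ∉ T.graph.side (f x) (f x₁) := hxy ▸ not_mem_side_self (f x) (f x₁)
          obtain ⟨d, hd, h1, h2⟩ := w.exists_boundary_dart (f ⁻¹' T.graph.side (f x) (f x₁)) hx₁ hy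
          have h1' : f d.fst ∈ T.graph.side (f x) (f x₁) := h1
          have h2' : f d.snd ∉ T.graph.side (f x) (f x₁) := h2
          have hne : f d.snd ≠ f d.fst := fun e => h2' (e ▸ h1')
          obtain ⟨e1, e2⟩ := T.isTree.eq_of_adj_side hadj h2' h1'
            (hf.toIsMap.adj_of_ne d.adj.symm hne)
          obtain ⟨e3, -⟩ := hf.inj_over _ _ _ _ d.adj.symm hx hne e1 e2
          have hxs : x ∈ w.support := e3 ▸ w.dart_snd_mem_support_of_mem_darts hd
          have := w.length_dropUntil_le_length hxs
          exact ih (w.dropUntil x hxs).length (by omega) x y _ rfl hxy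
  obtain ⟨w⟩ := S.isTree.connected x y
  exact key _ x y w rfl h

/-- A map which is constant on the edgelets collapsed by a collapse map factors through it. -/
theorem IsCollapse.exists_desc {p : S.V → T.V} {f : S.V → U.V} (hp : IsCollapse S T p)
    (hf : IsMap S U f) (h : ∀ a b, S.graph.Adj a b → p a = p b → f a = f b) :
    ∃ q : T.V → U.V, (∀ x, q (p x) = f x) ∧ IsMap T U q := by
  have hfib : ∀ x y, p x = p y → f x = f y := fun x y hxy =>
    (hp.reachable hxy).mem_of_closed (A := {z | f x = f z}) rfl (fun a b hab ha => by
      obtain ⟨h1, h2⟩ := hp.toIsMap.collapseGraph_adj.1 hab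
      exact Eq.trans ha (h a b h1 h2))
  choose s hs using hp.toIsMap.surjective
  have hq : ∀ x, f (s (p x)) = f x := fun x => hfib _ _ (hs _)
  refine ⟨fun t => f (s t), hq, ?_, ?_⟩
  · intro a b hab
    obtain ⟨x, y, hxy, rfl, rfl⟩ := hp.toIsMap.exists_lift hab
    rw [hq, hq]
    exact hf.simplicial x y hxy
  · intro g a
    obtain ⟨x, rfl⟩ := hp.toIsMap.surjective a
    rw [← hp.toIsMap.equivariant, hq, hq, hf.equivariant]

theorem IsCollapse.of_comp {p : S.V → T.V} {f : S.V → U.V} {q : T.V → U.V} (hp : IsMap S T p)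
    (hf : IsCollapse S U f) (hq : IsMap T U q) (h : ∀ x, q (p x) = f x) : IsCollapse T U q where
  toIsMap := hq
  inj_over a b c d hab hcd hne h1 h2 := by
    obtain ⟨x, y, hxy, rfl, rfl⟩ := hp.exists_lift hab
    obtain ⟨z, w, hzw, rfl, rfl⟩ := hp.exists_lift hcd
    rw [h, h] at hne h1 h2
    obtain ⟨rfl, rfl⟩ := hf.inj_over _ _ _ _ hxy hzw hne h1 h2
    exact ⟨rfl, rfl⟩

/-! ### The collapse of a subgraph -/

namespace InvSubgraph

variable (σ : T.InvSubgraph)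

/-- The action on the set of components (including the degenerate ones). -/
instance : MulAction F σ.graph.ConnectedComponent where
  smul g c := c.map ⟨fun x => g • x, fun {a b} h => σ.smul_adj g a b h⟩
  one_smul c := by
    induction c using ConnectedComponent.ind with
    | _ x => exact congrArg _ (one_smul F x)
  mul_smul g h c := by
    induction c using ConnectedComponent.ind with
    | _ x => exact congrArg _ (mul_smul g h x)

theorem mem_side_iff {p q x y : T.V} (h : T.graph.Adj p q) (hpq : ¬ σ.graph.Adj p q)
    (hxy : σ.graph.Reachable x y) : x ∈ T.graph.side p q ↔ y ∈ T.graph.side p q :=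
  not_iff_not.1 ⟨fun hx => T.isTree.not_mem_side_of_reachable σ.le h hpq hx hxy,
    fun hy => T.isTree.not_mem_side_of_reachable σ.le h hpq hy hxy.symm⟩

theorem eq_of_reachable {p q x y : T.V} (h : T.graph.Adj p q) (hpq : ¬ σ.graph.Adj p q)
    (hxy : T.graph.Adj x y) (hx : σ.graph.Reachable p x) (hy : σ.graph.Reachable q y) :
    p = x ∧ q = y := by
  obtain ⟨h1, h2⟩ := T.isTree.eq_of_adj_side h (mt (σ.mem_side_iff h hpq hx).2
    (not_mem_side_self p q)) ((σ.mem_side_iff h hpq hy).1 (mem_side_self h)) hxy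
  exact ⟨h1.symm, h2.symm⟩

theorem not_reachable_of_not_adj {p q : T.V} (h : T.graph.Adj p q) (hpq : ¬ σ.graph.Adj p q) :
    ¬ σ.graph.Reachable p q := fun hr =>
  not_mem_side_self p q ((σ.mem_side_iff h hpq hr).2 (mem_side_self h))

/-- The graph obtained by collapsing every component of `σ` to a point. -/
def collapsedGraph : SimpleGraph σ.graph.ConnectedComponent where
  Adj c d := ∃ x y, T.graph.Adj x y ∧ ¬ σ.graph.Adj x y ∧
    σ.graph.connectedComponentMk x = c ∧ σ.graph.connectedComponentMk y = d
  symm := ⟨by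
    rintro _ _ ⟨x, y, h, h', rfl, rfl⟩
    exact ⟨y, x, h.symm, fun e => h' e.symm, rfl, rfl⟩⟩
  loopless := ⟨by
    rintro c ⟨x, y, h, h', rfl, e⟩
    exact σ.not_reachable_of_not_adj h h' (ConnectedComponent.exact e).symm⟩

theorem collapsedGraph_reachable (x y : T.V) : σ.collapsedGraph.Reachable
    (σ.graph.connectedComponentMk x) (σ.graph.connectedComponentMk y) := by
  refine (T.isTree.connected x y).mem_of_closed
    (A := {z | σ.collapsedGraph.Reachable _ (σ.graph.connectedComponentMk z)})
    (Reachable.refl _) ?_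
  intro z w hzw hz
  by_cases h : σ.graph.Adj z w
  · change Reachable _ _ _
    rw [← ConnectedComponent.sound h.reachable]
    exact hz
  · exact Reachable.trans hz (Adj.reachable ⟨z, w, hzw, h, rfl, rfl⟩)

theorem collapsedGraph_isTree : σ.collapsedGraph.IsTree where
  connected := by
    have : Nonempty T.V := T.isTree.connected.nonempty
    have : Nonempty σ.graph.ConnectedComponent := this.map σ.graph.connectedComponentMk
    refine ⟨fun c d => ?_⟩
    induction c using ConnectedComponent.ind with | _ x => ?_
    induction d using ConnectedComponent.ind with | _ y => ?_
    exact σ.collapsedGraph_reachable x y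
  isAcyclic := by
    refine isAcyclic_of_cuts ?_
    rintro _ _ ⟨x, y, hxy, hσ, rfl, rfl⟩
    refine ⟨{c | ∃ z, σ.graph.connectedComponentMk z = c ∧ z ∉ T.graph.side x y},
      ⟨x, rfl, not_mem_side_self x y⟩, ?_, ?_⟩
    · rintro ⟨z, hz, hz'⟩
      exact hz' ((σ.mem_side_iff hxy hσ (ConnectedComponent.exact hz)).2 (mem_side_self hxy))
    · rintro _ ⟨a, rfl, ha⟩ _ hw ⟨u, w, huw, hσ', hu, rfl⟩
      have hu' := mt (σ.mem_side_iff hxy hσ (ConnectedComponent.exact hu)).1 ha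
      have hw' : w ∈ T.graph.side x y := by
        by_contra hc
        exact hw ⟨w, rfl, hc⟩
      obtain ⟨rfl, rfl⟩ := T.isTree.eq_of_adj_side hxy hu' hw' huw
      exact ⟨hu.symm, rfl⟩

/-- The free splitting obtained by collapsing every component of `σ` to a point. -/
def collapsed (hσ : ∃ a b, T.graph.Adj a b ∧ ¬ σ.graph.Adj a b) : FreeSplitting.{u, v} F where
  V := σ.graph.ConnectedComponent
  graph := σ.collapsedGraph
  act := inferInstance
  isTree := σ.collapsedGraph_isTree
  nontrivial := by
    obtain ⟨a, b, h, h'⟩ := hσ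
    exact ⟨σ.graph.connectedComponentMk a, σ.graph.connectedComponentMk b,
      fun e => σ.not_reachable_of_not_adj h h' (ConnectedComponent.exact e)⟩
  smul_adj := by
    rintro g _ _ ⟨x, y, h, h', rfl, rfl⟩
    refine ⟨g • x, g • y, T.smul_adj g _ _ h, fun e => h' ?_, rfl, rfl⟩
    simpa using σ.smul_adj g⁻¹ _ _ e
  minimal := by
    intro s hs hinv hc
    -- Minimality is inherited: as components of `σ` are connected, the preimage of a connected
    -- invariant set is connected and invariant.
    suffices h : {x | σ.graph.connectedComponentMk x ∈ s} = Set.univ by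
      refine Set.eq_univ_of_forall fun c => ?_
      induction c using ConnectedComponent.ind with
      | _ x => exact Set.eq_univ_iff_forall.1 h x
    refine T.eq_univ_of_reachable ?_ (fun g x hx => hinv g _ hx) (SimpleGraph.fromRel fun a b =>
      T.graph.Adj a b ∧ σ.graph.connectedComponentMk a ∈ s ∧ σ.graph.connectedComponentMk b ∈ s)
      ?_ ?_ ?_
    · obtain ⟨c, hc⟩ := hs
      induction c using ConnectedComponent.ind with
      | _ x => exact ⟨x, hc⟩
    · rintro a b ⟨-, h | h⟩
      · exact h.1
      · exact h.1.symm
    · rintro a b ⟨-, h | h⟩ -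
      · exact h.2.2
      · exact h.2.1
    · intro x hx y hy
      set H := SimpleGraph.fromRel fun a b => T.graph.Adj a b ∧
        σ.graph.connectedComponentMk a ∈ s ∧ σ.graph.connectedComponentMk b ∈ s with hH
      have step : ∀ z w, σ.graph.Reachable z w → σ.graph.connectedComponentMk z ∈ s →
          H.Reachable z w := by
        intro z w hzw hz
        refine (hzw.mem_of_closed (A := {w | H.Reachable z w ∧ σ.graph.connectedComponentMk w ∈ s})
          ⟨Reachable.refl _, hz⟩ ?_).1
        rintro a b hab ⟨h1, h2⟩
        have h3 : σ.graph.connectedComponentMk b ∈ s := by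
          rw [← ConnectedComponent.sound hab.reachable]
          exact h2
        exact ⟨h1.trans (Adj.reachable ⟨hab.ne, Or.inl ⟨σ.le hab, h2, h3⟩⟩), h3⟩
      refine (hc.preconnected ⟨_, hx⟩ ⟨_, hy⟩).mem_of_closed
        (A := {c | ∀ z, σ.graph.connectedComponentMk z = c.1 → H.Reachable x z})
        (fun z hz => (step z x (ConnectedComponent.exact hz) (hz ▸ hx)).symm) ?_ y rfl
      rintro ⟨_, hc⟩ ⟨_, hd⟩ ⟨u, w, huw, -, rfl, rfl⟩ hr z hz
      exact ((hr u rfl).trans (Adj.reachable ⟨huw.ne, Or.inl ⟨huw, hc, hd⟩⟩)).trans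
        (step w z (ConnectedComponent.exact hz.symm) hd)
  edge_stab := by
    rintro g _ _ ⟨x, y, h, h', rfl, rfl⟩ he
    have hg := T.smul_adj g _ _ h
    rw [Sym2.eq_iff] at he
    rcases he with ⟨h1, h2⟩ | ⟨h1, h2⟩
    · obtain ⟨e1, e2⟩ := σ.eq_of_reachable h h' hg (ConnectedComponent.exact h1).symm
        (ConnectedComponent.exact h2).symm
      exact T.eq_one_of_fix h e1.symm e2.symm
    · obtain ⟨e1, e2⟩ := σ.eq_of_reachable h h' hg.symm (ConnectedComponent.exact h2).symm
        (ConnectedComponent.exact h1).symm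
      exact T.eq_one_of_swap h e2.symm e1.symm

/-- The collapse map. -/
def toCollapsed (hσ : ∃ a b, T.graph.Adj a b ∧ ¬ σ.graph.Adj a b) : T.V → (σ.collapsed hσ).V :=
  σ.graph.connectedComponentMk

theorem toCollapsed_eq_iff (hσ : ∃ a b, T.graph.Adj a b ∧ ¬ σ.graph.Adj a b) {a b : T.V}
    (h : T.graph.Adj a b) : σ.toCollapsed hσ a = σ.toCollapsed hσ b ↔ σ.graph.Adj a b := by
  refine ⟨fun e => ?_, fun h' => ConnectedComponent.sound h'.reachable⟩
  by_contra h'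
  exact σ.not_reachable_of_not_adj h h' (ConnectedComponent.exact e)

theorem isCollapse_toCollapsed (hσ : ∃ a b, T.graph.Adj a b ∧ ¬ σ.graph.Adj a b) :
    IsCollapse T (σ.collapsed hσ) (σ.toCollapsed hσ) where
  simplicial a b h := by
    by_cases h' : σ.graph.Adj a b
    · exact Or.inl ((σ.toCollapsed_eq_iff hσ h).2 h')
    · exact Or.inr ⟨a, b, h, h', rfl, rfl⟩
  equivariant _ _ := rfl
  inj_over a b c d hab hcd hne h1 h2 :=
    σ.eq_of_reachable hab (fun h => hne ((σ.toCollapsed_eq_iff hσ hab).2 h)) hcd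
      (ConnectedComponent.exact h1) (ConnectedComponent.exact h2)

end InvSubgraph

end FreeSplitting

theorem Set.natCast_le_encard_iff {α : Type*} {s : Set α} {n : ℕ} :
    (n : ℕ∞) ≤ s.encard ↔ ∃ e : Fin n → α, Function.Injective e ∧ ∀ i, e i ∈ s := by
  constructor
  · intro h
    obtain ⟨t, hts, ht⟩ := Set.exists_subset_encard_eq h
    have hfin : t.Finite := Set.finite_of_encard_eq_coe ht
    have hcard : hfin.toFinset.card = n := by
      rw [hfin.encard_eq_coe_toFinset_card] at ht
      exact_mod_cast ht
    let e := (hfin.toFinset.equivFinOfCardEq hcard).symm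
    exact ⟨fun i => (e i).1, Subtype.val_injective.comp e.injective,
      fun i => hts (hfin.mem_toFinset.1 (e i).2)⟩
  · rintro ⟨e, he, hs⟩
    calc (n : ℕ∞) = (Set.range e).encard := by
          rw [← Set.image_univ, he.encard_image, Set.encard_univ, ENat.card_eq_coe_fintype_card,
            Fintype.card_fin]
      _ ≤ s.encard := Set.encard_le_encard (by rintro _ ⟨i, rfl⟩; exact hs i)

namespace FreeSplitting

open SimpleGraph

variable {F : Type u} [Group F]

/-! ### Cofiniteness -/

theorem _root_.SimpleGraph.Walk.reachable_of_support {V : Type*} {G H : SimpleGraph V} {a b : V}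
    (w : G.Walk a b)
    (h : ∀ x ∈ w.support, ∀ y ∈ w.support, G.Adj x y → H.Adj x y) : H.Reachable a b := by
  induction w with
  | nil => exact Reachable.refl _
  | cons hab w ih =>
    refine Reachable.trans (Adj.reachable (h _ (by simp) _ (by simp) hab)) (ih ?_)
    exact fun x hx y hy => h x (by simp [hx]) y (by simp [hy])

/-- Join x₀ to its translates by a finite generating set. The translates of these finitely many
paths form a connected invariant subgraph, which is everything by minimality. -/
theorem exists_finite_darts [Group.FG F] (T : FreeSplitting.{u, v} F) :
    ∃ E : Set (T.V × T.V), E.Finite ∧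
      ∀ a b, T.graph.Adj a b → ∃ g : F, (g • a, g • b) ∈ E := by
  obtain ⟨S, hS⟩ := (Group.fg_def (G := F)).1 inferInstance
  obtain ⟨x₀⟩ := T.isTree.connected.nonempty
  have hP : ∀ s : F, Nonempty (T.graph.Walk x₀ (s • x₀)) := fun s => T.isTree.connected _ _
  let P : ∀ s : F, T.graph.Walk x₀ (s • x₀) := fun s => (hP s).some
  let H : SimpleGraph T.V :=
    { Adj := fun x y => T.graph.Adj x y ∧
        ∃ g : F, ∃ s ∈ S, g • x ∈ (P s).support ∧ g • y ∈ (P s).support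
      symm := ⟨fun x y ⟨h, g, s, hs, h1, h2⟩ => ⟨h.symm, g, s, hs, h2, h1⟩⟩
      loopless := ⟨fun x h => h.1.ne rfl⟩ }
  have hsmul : ∀ (k : F) {x y}, H.Reachable x y → H.Reachable (k • x) (k • y) := by
    intro k x y h
    refine h.map ⟨fun x => k • x, ?_⟩
    rintro a b ⟨h, g, s, hs, h1, h2⟩
    exact ⟨T.smul_adj k _ _ h, g * k⁻¹, s, hs, by simpa [mul_smul] using h1,
      by simpa [mul_smul] using h2⟩
  have hgen : ∀ g : F, H.Reachable x₀ (g • x₀) := by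
    let K : Subgroup F :=
      { carrier := {g | H.Reachable x₀ (g • x₀)}
        one_mem' := by
          change H.Reachable x₀ ((1 : F) • x₀)
          rw [one_smul]
        mul_mem' := by
          intro a b (ha : H.Reachable _ _) (hb : H.Reachable _ _)
          change H.Reachable x₀ ((a * b) • x₀)
          rw [mul_smul]
          exact ha.trans (hsmul a hb)
        inv_mem' := by
          intro a (ha : H.Reachable _ _)
          change H.Reachable x₀ (a⁻¹ • x₀)
          have := hsmul a⁻¹ ha
          rw [inv_smul_smul] at this
          exact this.symm }
    have : Subgroup.closure (S : Set F) ≤ K := by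
      rw [Subgroup.closure_le]
      intro s hs
      refine (P s).reachable_of_support fun x hx y hy h => ⟨h, 1, s, hs, ?_, ?_⟩
      · rwa [one_smul]
      · rwa [one_smul]
    rw [hS] at this
    exact fun g => this (Subgroup.mem_top g)
  have huniv : {x | H.Reachable x₀ x} = Set.univ :=
    T.eq_univ_of_reachable ⟨x₀, Reachable.refl _⟩ (fun g x hx => (hgen g).trans (hsmul g hx)) H
      (fun _ _ h => h.1) (fun x y h hx => Reachable.trans hx h.reachable)
      (fun x hx y hy => Reachable.trans (Reachable.symm hx) hy)
  have hle : T.graph ≤ H := T.isTree.le_of_connected (fun _ _ h => h.1) fun x y =>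
    Reachable.trans (Reachable.symm (Set.eq_univ_iff_forall.1 huniv x))
      (Set.eq_univ_iff_forall.1 huniv y)
  refine ⟨⋃ s ∈ S, {x | x ∈ (P s).support} ×ˢ {x | x ∈ (P s).support},
    S.finite_toSet.biUnion fun s _ => (List.finite_toSet _).prod (List.finite_toSet _), ?_⟩
  intro a b hab
  obtain ⟨-, g, s, hs, h1, h2⟩ := hle hab
  exact ⟨g, Set.mem_biUnion hs ⟨h1, h2⟩⟩

instance finite_orbits [Group.FG F] (T : FreeSplitting.{u, v} F) :
    Finite (MulAction.orbitRel.Quotient F T.V) := by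
  obtain ⟨E, hE, h⟩ := T.exists_finite_darts
  have : Finite E := hE
  refine Finite.of_surjective
    (fun p : E => (Quotient.mk'' p.1.1 : MulAction.orbitRel.Quotient F T.V)) ?_
  intro q
  induction q using Quotient.inductionOn' with
  | _ x =>
    obtain ⟨y, hy⟩ := T.exists_adj x
    obtain ⟨g, hg⟩ := h x y hy
    exact ⟨⟨_, hg⟩, Quotient.sound' ⟨g, rfl⟩⟩

/-! ### Foldable maps and collapse maps -/

variable {S T S' T' U : FreeSplitting.{u, v} F}

theorem isNatural_iff {x : S.V} : S.IsNatural x ↔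
    ∃ n : Fin 3 → S.V, Function.Injective n ∧ ∀ i, S.graph.Adj x (n i) :=
  Set.natCast_le_encard_iff (n := 3)

theorem IsFoldable.adj {f : S.V → T.V} (hf : IsFoldable S T f) {a b : S.V} (h : S.graph.Adj a b) :
    T.graph.Adj (f a) (f b) :=
  hf.toIsMap.adj_of_ne h (hf.inj_edgelet a b h)

theorem IsFoldable.of_comp {f : S.V → T.V} {g : T.V → U.V} (hf : IsMap S T f)
    (h : IsFoldable S U (fun x => g (f x))) : IsFoldable S T f where
  toIsMap := hf
  inj_edgelet a b hab e := h.inj_edgelet a b hab (by rw [e])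
  two_gates x := (h.two_gates x).trans (by
    rw [← Set.image_image g f]
    exact Set.encard_image_le _ _)
  three_gates x hx := (h.three_gates x hx).trans (by
    rw [← Set.image_image g f]
    exact Set.encard_image_le _ _)

theorem exists_gates_iff {f : S.V → T.V} {x : S.V} {k : ℕ} :
    (k : ℕ∞) ≤ (f '' S.graph.neighborSet x).encard ↔
      ∃ n : Fin k → S.V, Function.Injective (fun i => f (n i)) ∧ ∀ i, S.graph.Adj x (n i) := by
  rw [Set.natCast_le_encard_iff]
  constructor
  · rintro ⟨e, he, h⟩
    choose n hn hne using h
    refine ⟨n, ?_, hn⟩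
    simpa only [hne] using he
  · rintro ⟨n, hn, h⟩
    exact ⟨_, hn, fun i => ⟨n i, h i, rfl⟩⟩

section collapse

variable {f : S.V → T.V} {f' : S'.V → T'.V} {π : S.V → S'.V} {ρ : T.V → T'.V}

/-- Having two gates at each vertex allows a path to be continued without its image backtracking.
The part of C ahead shrinks at each step, so the path leaves C, while the sides cut off by the image
edgelets are nested. -/
theorem IsFoldable.exists_exit (hf : IsFoldable S T f) {C : Set S.V} (hC : C.Finite) {x n : S.V}
    (hx : x ∈ C) (hxn : S.graph.Adj x n) : ∃ c e, c ∈ C ∧ e ∉ C ∧ S.graph.Adj c e ∧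
      T.graph.side (f c) (f e) ⊆ T.graph.side (f x) (f n) := by
  obtain ⟨k, hk⟩ : ∃ k, (C ∩ S.graph.side x n).ncard = k := ⟨_, rfl⟩
  induction k using Nat.strong_induction_on generalizing x n with
  | _ k ih =>
    by_cases hn : n ∈ C
    · obtain ⟨m, hm, hmn⟩ := exists_gates_iff.1 (hf.two_gates n)
      have hex : ∃ i, f (m i) ≠ f x := by
        by_contra! hcon
        exact absurd (hm ((hcon 0).trans (hcon 1).symm)) (by decide)
      obtain ⟨i, hi⟩ := hex
      have hix : m i ≠ x := fun e => hi (by rw [e])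
      obtain ⟨c, e, hc, he, hce, hs⟩ := ih (C ∩ S.graph.side n (m i)).ncard (by
        rw [← hk]
        refine Set.ncard_lt_ncard ⟨Set.inter_subset_inter_right _
          (S.isTree.side_subset_side hxn (hmn i) hix), fun h => ?_⟩ (hC.inter_of_left _)
        exact not_mem_side_self n (m i) (h ⟨hn, mem_side_self hxn⟩).2) hn (hmn i) rfl
      exact ⟨c, e, hc, he, hce, hs.trans (T.isTree.side_subset_side (hf.adj hxn)
        (hf.adj (hmn i)) hi)⟩
    · exact ⟨x, n, hx, hn, hxn, subset_rfl⟩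

variable (hf : IsFoldable S T f) (hπ : IsCollapse S S' π) (hρ : IsCollapse T T' ρ)
  (hcomm : ∀ x, ρ (f x) = f' (π x))
  (hc : ∀ a b, S.graph.Adj a b → (π a = π b ↔ ρ (f a) = ρ (f b)))

include hf hπ hρ hcomm hc

/-- Follow each gate at x until it leaves the collapsed fiber. The exit edgelets have images beyond
distinct directions at f x, so these images are distinct; they are not collapsed by `ρ`, so they
remain distinct directions in T'. -/
theorem IsFoldable.exists_gates_of_collapse {x : S.V} (hfin : (π ⁻¹' {π x}).Finite) {k : ℕ}
    {n : Fin k → S.V} (hn : Function.Injective fun i => f (n i)) (hxn : ∀ i, S.graph.Adj x (n i)) :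
    ∃ e : Fin k → S'.V, Function.Injective (fun i => f' (e i)) ∧
      ∀ i, S'.graph.Adj (π x) (e i) := by
  choose c e hcC he hce hs using fun i =>
    hf.exists_exit hfin (C := π ⁻¹' {π x}) (x := x) rfl (hxn i)
  have hcx : ∀ i, π (c i) = π x := hcC
  have hne : ∀ i, π (c i) ≠ π (e i) := fun i h => he i (h.symm.trans (hcx i))
  refine ⟨fun i => π (e i), fun i j hij => ?_, fun i => ?_⟩
  · have h1 : ρ (f (e i)) = ρ (f (e j)) := by
      rw [hcomm, hcomm]
      exact hij
    have h2 : ρ (f (c i)) = ρ (f (c j)) := by rw [hcomm, hcomm, hcx, hcx]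
    obtain ⟨-, h4⟩ := hρ.inj_over _ _ _ _ (hf.adj (hce i)) (hf.adj (hce j))
      (fun h => hne i ((hc _ _ (hce i)).2 h)) h2 h1
    have hi := hs i (mem_side_self (hf.adj (hce i)))
    have hj := hs j (mem_side_self (hf.adj (hce j)))
    rw [← h4] at hj
    exact hn (T.isTree.eq_of_mem_side (hf.adj (hxn i)) (hf.adj (hxn j)) hi hj)
  · have := hπ.toIsMap.adj_of_ne (hce i) (hne i)
    rwa [hcx] at this

/-- A map obtained from a foldable map by collapsing a subgraph of the target and its preimage
is foldable. -/
theorem IsFoldable.of_collapse [Group.FG F] [IsMulTorsionFree F] (hf' : IsMap S' T' f') :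
    IsFoldable S' T' f' := by
  have hinj : ∀ a b, S'.graph.Adj a b → f' a ≠ f' b := by
    intro a b hab
    obtain ⟨x, y, hxy, rfl, rfl⟩ := hπ.toIsMap.exists_lift hab
    rw [← hcomm, ← hcomm]
    exact fun h => hab.ne ((hc x y hxy).2 h)
  -- If π x has trivial stabilizer, its fiber injects into the finite set of vertex orbits.
  -- Otherwise the powers of a stabilizing element, which has infinite order, move one edgelet at π
  -- x to edgelets with distinct images, giving arbitrarily many gates.
  have key : ∀ x, (π ⁻¹' {π x}).Finite ∨
      ∀ k : ℕ, (k : ℕ∞) ≤ (f' '' S'.graph.neighborSet (π x)).encard := by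
    intro x
    by_cases hst : ∀ g : F, g • π x = π x → g = 1
    · left
      refine Set.Finite.of_finite_image (f := fun y =>
        (Quotient.mk'' y : MulAction.orbitRel.Quotient F S.V)) (Set.toFinite _) ?_
      intro y hy z hz hyz
      obtain ⟨g, hg⟩ := Quotient.exact' hyz
      have hg' : g • z = y := hg
      have : g = 1 := hst g (by
        calc g • π x = π (g • z) := by rw [hπ.toIsMap.equivariant, show π z = π x from hz]
          _ = π x := by rw [hg', show π y = π x from hy])
      rw [this, one_smul] at hg'
      exact hg'.symm
    · right
      push Not at hst
      obtain ⟨g, hg, hg1⟩ := hst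
      intro k
      obtain ⟨w, hw⟩ := S'.exists_adj (π x)
      have hgp : ∀ n : ℕ, g ^ n • π x = π x := fun n => by
        induction n with
        | zero => rw [pow_zero, one_smul]
        | succ n ih => rw [pow_succ, mul_smul, hg, ih]
      rw [exists_gates_iff]
      refine ⟨fun i => g ^ (i : ℕ) • w, fun i j hij => ?_, fun i => ?_⟩
      · dsimp only at hij
        rw [hf'.equivariant, hf'.equivariant] at hij
        have h1 := T'.eq_one_of_fix (g := (g ^ (j : ℕ))⁻¹ * g ^ (i : ℕ))
          (hf'.adj_of_ne hw (hinj _ _ hw))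
          (by rw [← hf'.equivariant, mul_smul, hgp, inv_smul_eq_iff.2 (hgp j).symm])
          (by rw [mul_smul, hij, inv_smul_smul])
        rw [inv_mul_eq_one] at h1
        have h2 : ¬ IsOfFinOrder g := not_isOfFinOrder_of_isMulTorsionFree hg1
        exact Fin.ext (injective_pow_iff_not_isOfFinOrder.2 h2 h1).symm
      · have := S'.smul_adj (g ^ (i : ℕ)) _ _ hw
        rwa [hgp] at this
  refine ⟨hf', hinj, fun v => ?_, fun v hv => ?_⟩
  · obtain ⟨x, rfl⟩ := hπ.toIsMap.surjective v
    rcases key x with hfin | h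
    · obtain ⟨n, hn, hxn⟩ := exists_gates_iff.1 (hf.two_gates x)
      exact exists_gates_iff.2 (hf.exists_gates_of_collapse hπ hρ hcomm hc hfin hn hxn)
    · exact h 2
  · obtain ⟨x, rfl⟩ := hπ.toIsMap.surjective v
    rcases key x with hfin | h
    · obtain ⟨e', he', hadj⟩ := isNatural_iff.1 hv
      choose c e hce hcx hee using fun i => hπ.toIsMap.exists_lift (hadj i)
      -- Three edgelets at π x lift to edgelets leaving the connected fiber, so the fiber contains a
      -- natural vertex, whose three gates can then be followed outwards.
      obtain ⟨m, hm, hnat⟩ := S.isTree.exists_three_adj (C := π ⁻¹' {π x}) (c := c) (e := e) (by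
          intro m hm n hn hmn c hc
          have hm' : π m = π x := hm
          refine S.isTree.not_mem_side_of_reachable (S.collapseGraph π).le hmn ?_
            (not_mem_side_self m n) (hπ.reachable (hm'.trans (Eq.symm hc)))
          rw [hπ.toIsMap.collapseGraph_adj]
          exact fun h => hn (h.2.symm.trans hm')) hcx
        (fun i h => (hadj i).ne (by rw [← hee i]; exact Eq.symm h)) hce
        (fun i j hij => he' (by rw [← hee, ← hee, hij]))
      have hm' : π m = π x := hm
      obtain ⟨n, hn, hmn⟩ := exists_gates_iff.1 (hf.three_gates m (isNatural_iff.2 hnat))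
      rw [← hm'] at hfin ⊢
      exact exists_gates_iff.2 (hf.exists_gates_of_collapse hπ hρ hcomm hc hfin hn hmn)
    · exact h 3

end collapse

end FreeSplitting

/-! ### Preimages of subgraphs, sequences and combing rectangles -/

namespace FreeSplitting

variable {F : Type u} [Group F] {S T : FreeSplitting.{u, v} F}

/-- The preimage of a subgraph. -/
def InvSubgraph.comap (σ : T.InvSubgraph) (f : Hom S T) : S.InvSubgraph where
  graph :=
    { Adj := fun a b => S.graph.Adj a b ∧ σ.graph.Adj (f.toFun a) (f.toFun b)
      symm := ⟨fun _ _ h => ⟨h.1.symm, h.2.symm⟩⟩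
      loopless := ⟨fun _ h => h.1.ne rfl⟩ }
  le := fun _ _ h => h.1
  smul_adj := fun g a b h => ⟨S.smul_adj g a b h.1, by
    rw [f.isMap.equivariant, f.isMap.equivariant]
    exact σ.smul_adj g _ _ h.2⟩

theorem isCollapse_cast (h : S = T) :
    IsCollapse S T (cast (congrArg FreeSplitting.V h)) ∧
      Function.Injective (cast (congrArg FreeSplitting.V h)) := by
  subst h
  exact ⟨⟨IsMap.id S, fun _ _ _ _ _ _ _ h1 h2 => ⟨h1, h2⟩⟩, Function.injective_id⟩

end FreeSplitting

namespace SplittingSeq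

open FreeSplitting

variable {F : Type u} [Group F]

/-- A finite sequence extends to an infinite one. -/
theorem exists_of_finite (J : ℕ) (A : ℕ → FreeSplitting.{u, v} F)
    (m : ∀ k, k < J → Hom (A k) (A (k + 1))) :
    ∃ (S : SplittingSeq.{u, v} F) (i : ∀ k, (A k).V → (S.obj k).V),
      (∀ k, k ≤ J → IsCollapse (A k) (S.obj k) (i k) ∧ Function.Injective (i k)) ∧
      ∀ k (h : k < J) x, i (k + 1) ((m k h).toFun x) = (S.map k).toFun (i k x) := by
  classical
  have hcast : ∀ {A B C D : FreeSplitting.{u, v} F} (h₁ : A = C) (h₂ : B = D) (f : Hom A B),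
      ∃ f' : Hom C D, ∀ x, cast (congrArg FreeSplitting.V h₂) (f.toFun x) =
        f'.toFun (cast (congrArg FreeSplitting.V h₁) x) := by
    rintro A B _ _ rfl rfl f
    exact ⟨f, fun _ => rfl⟩
  have hmap : ∀ k, ∃ f : Hom (A (min k J)) (A (min (k + 1) J)), ∀ (h : k < J) (x : (A k).V),
      cast (congrArg (fun n => (A n).V) (min_eq_left (Nat.succ_le_of_lt h)).symm)
        ((m k h).toFun x) =
      f.toFun (cast (congrArg (fun n => (A n).V) (min_eq_left h.le).symm) x) := by
    intro k
    by_cases h : k < J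
    · obtain ⟨f', hf'⟩ := hcast (congrArg A (min_eq_left h.le).symm)
        (congrArg A (min_eq_left (Nat.succ_le_of_lt h)).symm) (m k h)
      exact ⟨f', fun _ => hf'⟩
    · obtain ⟨f', -⟩ := hcast (rfl : A (min k J) = _)
        (congrArg A (by omega : min k J = min (k + 1) J)) (Hom.id (A (min k J)))
      exact ⟨f', fun h' => absurd h' h⟩
  choose f hf using hmap
  have hne : ∀ k, Nonempty (A k).V := fun k => (A k).isTree.connected.nonempty
  -- The sequence is constant after J. The casts identify A k with A (min k J) for k ≤ J; the
  -- vertical maps beyond J are arbitrary.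
  refine ⟨⟨fun k => A (min k J), f⟩, fun k x => if h : k ≤ J then
    cast (congrArg (fun n => (A n).V) (min_eq_left h).symm) x else (hne _).some, ?_, ?_⟩
  · intro k hk
    simp only [dif_pos hk]
    exact isCollapse_cast (congrArg A (min_eq_left hk).symm)
  · intro k hk x
    simp only [dif_pos hk.le, dif_pos (Nat.succ_le_of_lt hk)]
    exact hf k hk x

variable {S T U : SplittingSeq.{u, v} F}

theorem trans_trans (S : SplittingSeq.{u, v} F) {i j k : ℕ} (hij : i ≤ j) (hjk : j ≤ k)
    (x : (S.obj i).V) : (S.trans i k (hij.trans hjk)).toFun x =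
      (S.trans j k hjk).toFun ((S.trans i j hij).toFun x) := by
  induction k, hjk using Nat.le_induction with
  | base => rw [trans_self]; rfl
  | succ k hjk ih =>
    rw [trans_succ S i k (hij.trans hjk), trans_succ S j k hjk]
    exact congrArg _ ih

theorem trans_succ_self (S : SplittingSeq.{u, v} F) (i : ℕ) :
    (S.trans i (i + 1) (Nat.le_succ i)).toFun = (S.map i).toFun := by
  rw [trans_succ S i i le_rfl, trans_self]
  rfl

theorem trans_left (S : SplittingSeq.{u, v} F) {i j : ℕ} (h : i + 1 ≤ j) (x : (S.obj i).V) :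
    (S.trans i j ((Nat.le_succ i).trans h)).toFun x =
      (S.trans (i + 1) j h).toFun ((S.map i).toFun x) := by
  rw [trans_trans S (Nat.le_succ i) h, trans_succ_self]

theorem IsFoldableSeq.trans {i j : ℕ} (hS : S.IsFoldableSeq i j) {k l : ℕ} (hik : i ≤ k)
    (hkl : k ≤ l) (hlj : l ≤ j) : IsFoldable (S.obj k) (S.obj l) (S.trans k l hkl).toFun := by
  refine IsFoldable.of_comp (g := (S.trans l j hlj).toFun) (S.trans k l hkl).isMap ?_
  have := hS k hik (hkl.trans hlj)
  rwa [show (S.trans k j (hkl.trans hlj)).toFun = _ from funext (S.trans_trans hkl hlj)] at this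

theorem IsFoldableSeq.mono {i j i' j' : ℕ} (hS : S.IsFoldableSeq i j) (hi : i ≤ i') (hj : j' ≤ j) :
    S.IsFoldableSeq i' j' := fun _ h1 h2 => hS.trans (hi.trans h1) h2 hj

namespace IsCombingRectangle

variable {π : ∀ k, (S.obj k).V → (T.obj k).V} {ρ : ∀ k, (T.obj k).V → (U.obj k).V} {i j : ℕ}

theorem mono (h : IsCombingRectangle S T π i j) {i' j' : ℕ} (hi : i ≤ i') (hj : j' ≤ j) :
    IsCombingRectangle S T π i' j' where
  foldable := h.foldable.mono hi hj
  collapse k h1 h2 := h.collapse k (hi.trans h1) (h2.trans hj)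
  comm k h1 h2 := h.comm k (hi.trans h1) (h2.trans_le hj)
  preimage k h1 h2 := h.preimage k (hi.trans h1) (h2.trans_le hj)

theorem comm_trans (h : IsCombingRectangle S T π i j) {k l : ℕ} (hik : i ≤ k) (hkl : k ≤ l)
    (hlj : l ≤ j) (x : (S.obj k).V) :
    π l ((S.trans k l hkl).toFun x) = (T.trans k l hkl).toFun (π k x) := by
  induction l, hkl using Nat.le_induction with
  | base => rw [trans_self, trans_self]; rfl
  | succ l hkl ih =>
    rw [trans_succ S k l hkl, trans_succ T k l hkl]
    exact (h.comm l (hik.trans hkl) hlj _).trans (congrArg _ (ih (by omega)))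

theorem preimage_trans (h : IsCombingRectangle S T π i j) {k l : ℕ} (hik : i ≤ k) (hkl : k ≤ l)
    (hlj : l ≤ j) {a b : (S.obj k).V} (hab : (S.obj k).graph.Adj a b) :
    π k a = π k b ↔ π l ((S.trans k l hkl).toFun a) = π l ((S.trans k l hkl).toFun b) := by
  induction l, hkl using Nat.le_induction with
  | base => rw [trans_self]; rfl
  | succ l hkl ih =>
    rw [trans_succ S k l hkl, ih (by omega)]
    exact h.preimage l (hik.trans hkl) hlj _ _
      ((h.foldable.trans hik hkl (by omega)).adj hab)

/-- The bottom row of a combing rectangle is a foldable sequence. -/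
theorem foldable_bottom [Group.FG F] [IsMulTorsionFree F] (h : IsCombingRectangle S T π i j) :
    T.IsFoldableSeq i j := fun k hik hkj =>
  (h.foldable k hik hkj).of_collapse (h.collapse k hik hkj) (h.collapse j (hik.trans hkj) le_rfl)
    (h.comm_trans hik hkj le_rfl) (fun _ _ hab => h.preimage_trans hik hkj le_rfl hab)
    (T.trans k j hkj).isMap

theorem comp (h : IsCombingRectangle S T π i j) (h' : IsCombingRectangle T U ρ i j) :
    IsCombingRectangle S U (fun k x => ρ k (π k x)) i j where
  foldable := h.foldable
  collapse k h1 h2 := (h'.collapse k h1 h2).comp (h.collapse k h1 h2)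
  comm k h1 h2 x := by
    rw [h.comm k h1 h2, h'.comm k h1 h2]
  preimage k h1 h2 a b hab := by
    rw [h.comm k h1 h2, h.comm k h1 h2]
    rcases (h.collapse k h1 h2.le).simplicial a b hab with e | e
    · rw [e]
      exact iff_of_true rfl rfl
    · exact h'.preimage k h1 h2 _ _ e

/-- A combing rectangle factors through any combing rectangle with smaller collapse graphs. -/
theorem exists_factor [Group.FG F] [IsMulTorsionFree F] {π' : ∀ k, (S.obj k).V → (U.obj k).V}
    (h : IsCombingRectangle S T π i j) (h' : IsCombingRectangle S U π' i j)
    (hle : ∀ k, i ≤ k → k ≤ j → ∀ a b, (S.obj k).graph.Adj a b → π k a = π k b → π' k a = π' k b) :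
    ∃ q : ∀ k, (T.obj k).V → (U.obj k).V, IsCombingRectangle T U q i j ∧
      ∀ k, i ≤ k → k ≤ j → ∀ x, q k (π k x) = π' k x := by
  have hex : ∀ k, ∃ q : (T.obj k).V → (U.obj k).V, i ≤ k → k ≤ j →
      (∀ x, q (π k x) = π' k x) ∧ IsMap (T.obj k) (U.obj k) q := by
    intro k
    by_cases hk : i ≤ k ∧ k ≤ j
    · obtain ⟨q, hq⟩ := (h.collapse k hk.1 hk.2).exists_desc (h'.collapse k hk.1 hk.2).toIsMap
        (hle k hk.1 hk.2)
      exact ⟨q, fun _ _ => hq⟩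
    -- Outside the interval any function will do.
    · obtain ⟨y⟩ := (U.obj k).isTree.connected.nonempty
      exact ⟨fun _ => y, fun h1 h2 => absurd ⟨h1, h2⟩ hk⟩
  choose q hq using hex
  refine ⟨q, ⟨h.foldable_bottom, fun k h1 h2 => ?_, fun k h1 h2 x => ?_, ?_⟩,
    fun k h1 h2 => (hq k h1 h2).1⟩
  · exact (h'.collapse k h1 h2).of_comp (h.collapse k h1 h2).toIsMap (hq k h1 h2).2 (hq k h1 h2).1
  · obtain ⟨x, rfl⟩ := (h.collapse k h1 h2.le).toIsMap.surjective x
    rw [← h.comm k h1 h2, (hq (k + 1) (by omega) h2).1, (hq k h1 h2.le).1, h'.comm k h1 h2]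
  · intro k h1 h2 a b hab
    obtain ⟨x, y, hxy, rfl, rfl⟩ := (h.collapse k h1 h2.le).toIsMap.exists_lift hab
    rw [← h.comm k h1 h2, ← h.comm k h1 h2, (hq (k + 1) (by omega) h2).1,
      (hq (k + 1) (by omega) h2).1, (hq k h1 h2.le).1, (hq k h1 h2.le).1]
    exact h'.preimage k h1 h2 x y hxy

end IsCombingRectangle

/-- A proper subgraph of the last term of a foldable sequence is the last collapse graph of a
combing rectangle. -/
theorem IsFoldableSeq.exists_collapse {J : ℕ} (hS : S.IsFoldableSeq 0 J)
    (σ : (S.obj J).InvSubgraph) (hσ : ∃ a b, (S.obj J).graph.Adj a b ∧ ¬ σ.graph.Adj a b) :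
    ∃ (T : SplittingSeq.{u, v} F) (p : ∀ k, (S.obj k).V → (T.obj k).V),
      IsCombingRectangle S T p 0 J ∧ ∀ k (hk : k ≤ J) a b, (S.obj k).graph.Adj a b →
        (p k a = p k b ↔
          σ.graph.Adj ((S.trans k J hk).toFun a) ((S.trans k J hk).toFun b)) := by
  have hex : ∀ k, ∃ (A : FreeSplitting.{u, v} F) (p : (S.obj k).V → A.V), IsCollapse (S.obj k) A p ∧
      ∀ (hk : k ≤ J) a b, (S.obj k).graph.Adj a b → (p a = p b ↔
        σ.graph.Adj ((S.trans k J hk).toFun a) ((S.trans k J hk).toFun b)) := by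
    intro k
    by_cases hk : k ≤ J
    · have hproper : ∃ a b, (S.obj k).graph.Adj a b ∧
          ¬ (σ.comap (S.trans k J hk)).graph.Adj a b := by
        obtain ⟨a, b, hab, h⟩ := hσ
        obtain ⟨x, y, hxy, rfl, rfl⟩ := (S.trans k J hk).isMap.exists_lift hab
        exact ⟨x, y, hxy, fun h' => h h'.2⟩
      refine ⟨_, _, InvSubgraph.isCollapse_toCollapsed _ hproper, fun _ a b hab => ?_⟩
      rw [InvSubgraph.toCollapsed_eq_iff _ _ hab]
      exact ⟨fun h => h.2, fun h => ⟨hab, h⟩⟩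
    · exact ⟨S.obj k, fun x => x, ⟨IsMap.id _, fun _ _ _ _ _ _ _ h1 h2 => ⟨h1, h2⟩⟩,
        fun h => absurd h hk⟩
  choose A p hp hpσ using hex
  have hpre : ∀ k (_ : k < J) a b, (S.obj k).graph.Adj a b → (p k a = p k b ↔
      p (k + 1) ((S.map k).toFun a) = p (k + 1) ((S.map k).toFun b)) := by
    intro k hk a b hab
    have hadj := (hS.trans k.zero_le k.le_succ hk).adj hab
    rw [trans_succ_self] at hadj
    rw [hpσ k hk.le a b hab, hpσ (k + 1) hk _ _ hadj, trans_left S hk, trans_left S hk]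
  have hm : ∀ k (_ : k < J), ∃ m : Hom (A k) (A (k + 1)),
      ∀ x, m.toFun (p k x) = p (k + 1) ((S.map k).toFun x) := by
    intro k hk
    obtain ⟨q, hq, hq'⟩ := (hp k).exists_desc ((hp (k + 1)).toIsMap.comp (S.map k).isMap)
      (fun a b hab h => (hpre k hk a b hab).1 h)
    exact ⟨⟨q, hq'⟩, hq⟩
  choose m hm using hm
  obtain ⟨T, i, hi, hcomm⟩ := exists_of_finite J A m
  refine ⟨T, fun k x => i k (p k x), ⟨hS, fun k _ hk => ?_, fun k _ hk x => ?_, ?_⟩, ?_⟩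
  · exact (hi k hk).1.comp (hp k)
  · rw [← hcomm k hk, hm k hk]
  · intro k _ hk a b hab
    rw [(hi k hk.le).2.eq_iff, (hi (k + 1) hk).2.eq_iff]
    exact hpre k hk a b hab
  · intro k hk a b hab
    rw [(hi k hk).2.eq_iff]
    exact hpσ k hk a b hab

end SplittingSeq

/-! ### Additive functions on groups -/

/-- The space of homomorphisms to the additive group of the rational numbers. -/
def additiveFun (G : Type*) [Group G] : Submodule ℚ (G → ℚ) where
  carrier := {φ | ∀ g h, φ (g * h) = φ g + φ h}
  add_mem' {φ ψ} hφ hψ g h := by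
    simp only [Pi.add_apply, hφ g h, hψ g h]
    ring
  zero_mem' _ _ := by simp
  smul_mem' c φ hφ g h := by
    simp only [Pi.smul_apply, hφ g h, smul_add]

namespace additiveFun

variable {G : Type*} [Group G]

theorem apply_mul (φ : additiveFun G) (g h : G) : φ.1 (g * h) = φ.1 g + φ.1 h := φ.2 g h

theorem apply_one (φ : additiveFun G) : φ.1 1 = 0 := by
  have := apply_mul φ 1 1
  rw [mul_one] at this
  linarith

theorem apply_inv (φ : additiveFun G) (g : G) : φ.1 g⁻¹ = - φ.1 g := by
  have := apply_mul φ g g⁻¹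
  rw [mul_inv_cancel, apply_one φ] at this
  linarith

/-- The corresponding homomorphism. -/
def toHom (φ : additiveFun G) : G →* Multiplicative ℚ where
  toFun g := Multiplicative.ofAdd (φ.1 g)
  map_one' := congrArg _ (apply_one φ)
  map_mul' g h := congrArg _ (apply_mul φ g h)

/-- A homomorphism from a free group is determined by its arbitrary values on the generators. -/
def equivGenerators (G : Type*) [Group G] [IsFreeGroup G] :
    additiveFun G ≃ₗ[ℚ] (IsFreeGroup.Generators G → ℚ) where
  toFun φ x := φ.1 (IsFreeGroup.of x)
  map_add' _ _ := rfl
  map_smul' _ _ := rfl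
  invFun f := ⟨fun g => Multiplicative.toAdd
    (IsFreeGroup.lift (fun x => Multiplicative.ofAdd (f x)) g), fun g h => by
      simp only [map_mul, toAdd_mul]⟩
  left_inv φ := by
    have : IsFreeGroup.lift (fun x => Multiplicative.ofAdd (φ.1 (IsFreeGroup.of x))) = toHom φ :=
      IsFreeGroup.ext_hom fun x => by
        rw [IsFreeGroup.lift_of]
        rfl
    refine Subtype.ext (funext fun g => ?_)
    simp only [this]
    rfl
  right_inv f := by
    funext x
    simp only [IsFreeGroup.lift_of, toAdd_ofAdd]

theorem finite_generators (G : Type*) [Group G] [IsFreeGroup G] [Module.Finite ℚ (additiveFun G)] :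
    Finite (IsFreeGroup.Generators G) := by
  classical
  have := Module.Finite.equiv (equivGenerators G)
  exact (Pi.linearIndependent_single_one (IsFreeGroup.Generators G) ℚ).finite

/-- This turns ranks of free groups into dimensions, so that they can be compared through linear
maps. -/
theorem finrank_eq (G : Type*) [Group G] [IsFreeGroup G] [Module.Finite ℚ (additiveFun G)] :
    Module.finrank ℚ (additiveFun G) = freeRank G := by
  have := finite_generators G
  have := Fintype.ofFinite (IsFreeGroup.Generators G)
  rw [(equivGenerators G).finrank_eq, Module.finrank_pi, freeRank, Nat.card_eq_fintype_card]

instance (G : Type*) [Group G] [IsFreeGroup G] [Finite (IsFreeGroup.Generators G)] :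
    Module.Finite ℚ (additiveFun G) :=
  Module.Finite.equiv (equivGenerators G).symm

/-- The restriction to a family of subgroups. -/
def restrict {Q : Type*} (H : Q → Subgroup G) :
    additiveFun G →ₗ[ℚ] (∀ q, additiveFun (H q)) where
  toFun φ _ := ⟨fun h => φ.1 h, fun g h => φ.2 g h⟩
  map_add' _ _ := rfl
  map_smul' _ _ := rfl

theorem mem_ker_restrict {Q : Type*} {H : Q → Subgroup G} {φ : additiveFun G} :
    φ ∈ LinearMap.ker (restrict H) ↔ ∀ q, ∀ h ∈ H q, φ.1 h = 0 := by
  rw [LinearMap.mem_ker]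
  constructor
  · intro h q g hg
    exact congrArg (fun x : ∀ q, additiveFun (H q) => (x q).1 ⟨g, hg⟩) h
  · intro h
    funext q
    exact Subtype.ext (funext fun g => h q g g.2)

theorem finite_of_restrict_surjective {Q : Type*} {H : Q → Subgroup G} [IsFreeGroup G]
    [Finite (IsFreeGroup.Generators G)] (hH : Function.Surjective (restrict H)) (q : Q) :
    Module.Finite ℚ (additiveFun (H q)) := by
  classical
  exact Module.Finite.of_surjective ((LinearMap.proj q).comp (restrict H))
    ((Function.surjective_eval q).comp hH)

theorem finrank_ker_restrict {Q : Type*} [Fintype Q] {H : Q → Subgroup G} [IsFreeGroup G]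
    [Finite (IsFreeGroup.Generators G)] (hH : Function.Surjective (restrict H)) :
    Module.finrank ℚ (LinearMap.ker (restrict H)) + ∑ q, freeRank (H q) = freeRank G := by
  have hfin := finite_of_restrict_surjective hH
  have := (restrict H).finrank_range_add_finrank_ker
  rw [LinearMap.range_eq_top.2 hH, finrank_top, Module.finrank_pi_fintype, finrank_eq] at this
  simp only [finrank_eq] at this
  omega

end additiveFun

/-! ### Quasi-invariant functions -/

/-- Functions on a `G`-set which are equivariant for some action of `G` by translations. -/
def quasiInv (G Y : Type*) [Group G] [MulAction G Y] : Submodule ℚ (Y → ℚ) where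
  carrier := {u | ∃ ψ ∈ additiveFun G, ∀ (g : G) (y : Y), u (g • y) = u y + ψ g}
  add_mem' := by
    rintro u w ⟨ψ, hψ, hu⟩ ⟨χ, hχ, hw⟩
    refine ⟨ψ + χ, add_mem hψ hχ, fun g y => ?_⟩
    simp only [Pi.add_apply, hu, hw]
    ring
  zero_mem' := ⟨0, zero_mem _, fun _ _ => by simp⟩
  smul_mem' := by
    rintro c u ⟨ψ, hψ, hu⟩
    refine ⟨c • ψ, Submodule.smul_mem _ c hψ, fun g y => ?_⟩
    simp only [Pi.smul_apply, hu, smul_add]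

namespace quasiInv

variable {G Y Z : Type*} [Group G] [MulAction G Y] [MulAction G Z]

/-- The translation action associated with a quasi-invariant function. -/
def toAdditive (y₀ : Y) : quasiInv G Y →ₗ[ℚ] additiveFun G where
  toFun u := ⟨fun g => u.1 (g • y₀) - u.1 y₀, fun g h => by
    obtain ⟨ψ, hψ, hu⟩ := u.2
    simp only [hu, hψ g h]
    ring⟩
  map_add' u w := Subtype.ext (funext fun g => by
    simp only [Submodule.coe_add, Pi.add_apply]
    ring)
  map_smul' c u := Subtype.ext (funext fun g => by
    simp only [Submodule.coe_smul, Pi.smul_apply, RingHom.id_apply, smul_sub])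

theorem apply_smul (y₀ : Y) (u : quasiInv G Y) (g : G) (y : Y) :
    u.1 (g • y) = u.1 y + (toAdditive y₀ u).1 g := by
  obtain ⟨ψ, hψ, hu⟩ := u.2
  change _ = _ + (u.1 (g • y₀) - u.1 y₀)
  rw [hu, hu]
  ring

section orbits

variable {Q : Type*} {y : Q → Y} {H : Q → Subgroup G}

/-- Quasi-invariant functions are determined by the action and by their values on representatives
of the orbits. -/
def toProd (y₀ : Y) (hH : ∀ q g, g ∈ H q ↔ g • y q = y q) :
    quasiInv G Y →ₗ[ℚ] LinearMap.ker (additiveFun.restrict H) × (Q → ℚ) :=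
  ((toAdditive y₀).codRestrict _ fun u => by
    rw [additiveFun.mem_ker_restrict]
    intro q h hh
    have := apply_smul y₀ u h (y q)
    rw [(hH q h).1 hh] at this
    linarith).prod
  { toFun := fun u q => u.1 (y q)
    map_add' := fun _ _ => rfl
    map_smul' := fun _ _ => rfl }

/-- Given the translation action φ and the values c on orbit representatives, the only candidate is
u (g • y q) = c q + φ g; it is well defined because φ vanishes on the stabilizers. -/
theorem toProd_bijective (y₀ : Y) (hH : ∀ q g, g ∈ H q ↔ g • y q = y q)
    (horb : ∀ z, ∃ (q : Q) (g : G), g • y q = z)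
    (hdis : ∀ q q' (g : G), g • y q = y q' → q = q') :
    Function.Bijective (toProd y₀ hH) := by
  constructor
  · intro u w hu
    refine Subtype.ext (funext fun z => ?_)
    obtain ⟨q, g, rfl⟩ := horb z
    have h1 : (toAdditive y₀ u).1 g = (toAdditive y₀ w).1 g :=
      congrArg (fun p : LinearMap.ker (additiveFun.restrict H) × (Q → ℚ) => p.1.1.1 g) hu
    have h2 : u.1 (y q) = w.1 (y q) := congrFun (congrArg Prod.snd hu) q
    rw [apply_smul y₀, apply_smul y₀, h1, h2]
  · rintro ⟨⟨φ, hφ⟩, c⟩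
    rw [additiveFun.mem_ker_restrict] at hφ
    choose o s hs using horb
    have hwd : ∀ q g, c (o (g • y q)) + φ.1 (s (g • y q)) = c q + φ.1 g := by
      intro q g
      have h1 : o (g • y q) = q := hdis _ _ (g⁻¹ * s (g • y q)) (by
        rw [mul_smul, hs, inv_smul_smul])
      have h2 : g⁻¹ * s (g • y q) ∈ H q := by
        rw [hH]
        nth_rewrite 2 [← h1]
        rw [mul_smul, hs, inv_smul_smul]
      have h3 := hφ _ _ h2
      rw [additiveFun.apply_mul φ, additiveFun.apply_inv φ] at h3
      rw [h1]
      linarith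
    have hu : (fun z => c (o z) + φ.1 (s z)) ∈ quasiInv G Y := by
      refine ⟨φ.1, φ.2, fun g z => ?_⟩
      have h1 := hwd (o z) (g * s z)
      rw [mul_smul, hs, additiveFun.apply_mul φ] at h1
      linarith
    refine ⟨⟨_, hu⟩, Prod.ext (Subtype.ext (Subtype.ext (funext fun g => ?_)))
      (funext fun q => ?_)⟩
    · have h1 := hwd (o y₀) (g * s y₀)
      rw [mul_smul, hs, additiveFun.apply_mul φ] at h1
      change c (o (g • y₀)) + φ.1 (s (g • y₀)) - (c (o y₀) + φ.1 (s y₀)) = φ.1 g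
      linarith
    · have h1 := hwd q 1
      rw [one_smul, additiveFun.apply_one φ] at h1
      change c (o (y q)) + φ.1 (s (y q)) = c q
      linarith

variable [IsFreeGroup G] [Finite (IsFreeGroup.Generators G)] [Fintype Q] (y₀ : Y)
  (hH : ∀ q g, g ∈ H q ↔ g • y q = y q) (horb : ∀ z, ∃ (q : Q) (g : G), g • y q = z)
  (hdis : ∀ q q' (g : G), g • y q = y q' → q = q')

include y₀ hH horb hdis

theorem module_finite : Module.Finite ℚ (quasiInv G Y) :=
  Module.Finite.equiv (LinearEquiv.ofBijective _ (toProd_bijective y₀ hH horb hdis)).symm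

/-- For the set of components of a subgraph, this exhibits the complexity as a dimension.
Surjectivity of the restriction allows the ranks of the stabilizers to be subtracted by
rank-nullity. -/
theorem finrank_add_sum (hsurj : Function.Surjective (additiveFun.restrict H)) :
    Module.finrank ℚ (quasiInv G Y) + ∑ q, freeRank (H q) = Fintype.card Q + freeRank G := by
  have : Module.Free ℚ (LinearMap.ker (additiveFun.restrict H)) :=
    @Module.Free.of_divisionRing ℚ _ _ (Submodule.addCommGroup _) (Submodule.module _)
  rw [(LinearEquiv.ofBijective _ (toProd_bijective y₀ hH horb hdis)).finrank_eq,
    Module.finrank_prod, Module.finrank_pi]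
  have := additiveFun.finrank_ker_restrict hsurj
  omega

end orbits

/-- The pullback of quasi-invariant functions. -/
def comap (p : Y → Z) (hp : ∀ (g : G) y, p (g • y) = g • p y) : quasiInv G Z →ₗ[ℚ] quasiInv G Y where
  toFun u := ⟨fun y => u.1 (p y), by
    obtain ⟨ψ, hψ, hu⟩ := u.2
    exact ⟨ψ, hψ, fun g y => by simp only [hp, hu]⟩⟩
  map_add' _ _ := rfl
  map_smul' _ _ := rfl

theorem comap_injective {p : Y → Z} (hp : ∀ (g : G) y, p (g • y) = g • p y)
    (hsurj : Function.Surjective p) : Function.Injective (comap p hp) := by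
  intro u w h
  refine Subtype.ext (funext fun z => ?_)
  obtain ⟨y, rfl⟩ := hsurj z
  exact congrArg (fun t : quasiInv G Y => t.1 y) h

theorem one_le_finrank [Nonempty Y] [Module.Finite ℚ (quasiInv G Y)] :
    1 ≤ Module.finrank ℚ (quasiInv G Y) := by
  rw [Nat.one_le_iff_ne_zero, Ne, Module.finrank_zero_iff, not_subsingleton_iff_nontrivial]
  have h : (fun _ : Y => (1 : ℚ)) ∈ quasiInv G Y := ⟨0, zero_mem _, fun _ _ => by simp⟩
  refine ⟨⟨_, h⟩, 0, fun e => ?_⟩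
  obtain ⟨y⟩ := ‹Nonempty Y›
  exact one_ne_zero (congrArg (fun t : quasiInv G Y => t.1 y) e)

end quasiInv

/-- A homomorphism on a point stabilizer extends to a cocycle supported on an orbit. -/
theorem exists_cocycle {G Y : Type*} [Group G] [MulAction G Y] (p : Y) {H : Subgroup G}
    (hH : ∀ g, g ∈ H ↔ g • p = p) (φ : additiveFun H) :
    ∃ a : G → Y → ℚ, (∀ g h y, a (g * h) y = a g (h • y) + a h y) ∧
      (∀ h : H, a h p = φ.1 h) ∧ ∀ y, (∀ g : G, g • p ≠ y) → ∀ g, a g y = 0 := by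
  classical
  have hs : ∀ y, ∃ s : G, (∃ g : G, g • p = y) → s • p = y := by
    intro y
    by_cases h : ∃ g : G, g • p = y
    · exact ⟨h.choose, fun _ => h.choose_spec⟩
    · exact ⟨1, fun h' => absurd h' h⟩
  choose s hs using hs
  let φ' : G → ℚ := fun g => if h : g ∈ H then φ.1 ⟨g, h⟩ else 0
  have hφ' : ∀ g h, g ∈ H → h ∈ H → φ' (g * h) = φ' g + φ' h := by
    intro g h hg hh
    simp only [φ', dif_pos hg, dif_pos hh, dif_pos (mul_mem hg hh)]
    exact additiveFun.apply_mul φ ⟨g, hg⟩ ⟨h, hh⟩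
  have hφ1 : φ' 1 = 0 := by
    have := hφ' 1 1 (one_mem _) (one_mem _)
    rw [mul_one] at this
    linarith
  have hmem : ∀ g y, (∃ k : G, k • p = y) → (s (g • y))⁻¹ * g * s y ∈ H := by
    intro g y hy
    rw [hH, mul_smul, mul_smul, hs y hy, inv_smul_eq_iff, hs]
    obtain ⟨k, rfl⟩ := hy
    exact ⟨g * k, mul_smul _ _ _⟩
  -- With s y carrying p to y, the element s(gy)⁻¹ g s(y) fixes p; this is the induced cocycle. The
  -- choice of s p in H does not affect the value at p, because φ takes commutative values.
  refine ⟨fun g y => if ∃ k : G, k • p = y then φ' ((s (g • y))⁻¹ * g * s y) else 0, ?_, ?_, ?_⟩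
  · intro g h y
    by_cases hy : ∃ k : G, k • p = y
    · have hy' : ∃ k : G, k • p = h • y := by
        obtain ⟨k, rfl⟩ := hy
        exact ⟨h * k, mul_smul _ _ _⟩
      simp only [if_pos hy, if_pos hy']
      rw [← hφ' _ _ (hmem g _ hy') (hmem h y hy), mul_smul]
      congr 1
      group
    · have hy' : ¬ ∃ k : G, k • p = h • y := by
        rintro ⟨k, hk⟩
        exact hy ⟨h⁻¹ * k, by rw [mul_smul, hk, inv_smul_smul]⟩
      simp only [if_neg hy, if_neg hy', add_zero]
  · intro h
    have hp : ∃ k : G, k • p = p := ⟨1, one_smul _ _⟩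
    have hsp : s p ∈ H := (hH _).2 (hs p hp)
    simp only [if_pos hp]
    rw [(hH _).1 h.2, hφ' _ _ (mul_mem (inv_mem hsp) h.2) hsp, hφ' _ _ (inv_mem hsp) h.2]
    have h1 := hφ' _ _ (inv_mem hsp) hsp
    rw [inv_mul_cancel, hφ1] at h1
    have h2 : φ' h = φ.1 h := by simp [φ']
    linarith
  · intro y hy g
    exact if_neg fun ⟨k, hk⟩ => hy k hk

theorem groupFG_of_finite_generators (F : Type u) [Group F] [IsFreeGroup F]
    [Finite (IsFreeGroup.Generators F)] : Group.FG F :=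
  Group.fg_of_surjective (f := (IsFreeGroup.toFreeGroup F).symm.toMonoidHom)
    (IsFreeGroup.toFreeGroup F).symm.surjective

theorem isMulTorsionFree_of_isFreeGroup (F : Type u) [Group F] [IsFreeGroup F] :
    IsMulTorsionFree F :=
  (IsFreeGroup.toFreeGroup F).injective.isMulTorsionFree (IsFreeGroup.toFreeGroup F).toMonoidHom

theorem one_le_freeRank {G : Type u} [Group G] [IsFreeGroup G] [Finite (IsFreeGroup.Generators G)]
    {g : G} (hg : g ≠ 1) : 1 ≤ freeRank G := by
  rw [freeRank, Nat.one_le_iff_ne_zero, Ne, Nat.card_eq_zero, not_or]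
  refine ⟨fun h => hg ?_, fun h => not_finite_iff_infinite.2 h ‹_›⟩
  have : MonoidHom.id G = 1 := IsFreeGroup.ext_hom fun a => h.elim a
  exact DFunLike.congr_fun this g

/-- The antisymmetric functions for a free involution. -/
theorem card_le_two_mul_finrank {D : Type*} [Fintype D] (ι : D → D) (hι : ∀ d, ι (ι d) = d)
    (hfree : ∀ d, ι d ≠ d) (A : Submodule ℚ (D → ℚ))
    (hA : ∀ c : D → ℚ, (∀ d, c (ι d) = - c d) → c ∈ A) :
    Fintype.card D ≤ 2 * Module.finrank ℚ A := by
  classical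
  let e := Fintype.equivFin D
  -- An arbitrary choice of one element in each pair {d, ι d}, recorded as an antisymmetric sign.
  let ε : D → ℚ := fun d => if e d < e (ι d) then 1 else -1
  have hε : ∀ d, ε (ι d) = - ε d := by
    intro d
    have hne : e (ι d) ≠ e d := fun h => hfree d (e.injective h)
    simp only [ε, hι]
    rcases lt_or_gt_of_ne hne with h | h
    · rw [if_pos h, if_neg (not_lt_of_gt h), neg_neg]
    · rw [if_neg (not_lt_of_gt h), if_pos h]
  have hε0 : ∀ d, ε d ≠ 0 := by
    intro d
    simp only [ε]
    split_ifs <;> norm_num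
  -- The range of L consists of antisymmetric functions and its kernel of symmetric ones, which ε
  -- makes antisymmetric. Both dimensions are thus at most that of A, and they add up to the
  -- cardinality of D.
  let L : (D → ℚ) →ₗ[ℚ] (D → ℚ) := LinearMap.id - LinearMap.funLeft ℚ ℚ ι
  have hL : ∀ c d, L c d = c d - c (ι d) := fun _ _ => rfl
  have h1 : Module.finrank ℚ (LinearMap.range L) ≤ Module.finrank ℚ A := by
    refine Submodule.finrank_mono ?_
    rintro _ ⟨c, rfl⟩
    refine hA _ fun d => ?_
    rw [hL, hL, hι]
    ring
  let M : (D → ℚ) →ₗ[ℚ] (D → ℚ) := LinearMap.mulLeft ℚ ε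
  have hM : Function.Injective M := by
    intro c c' h
    funext d
    have := congrFun h d
    exact mul_left_cancel₀ (hε0 d) this
  have h2 : Module.finrank ℚ (LinearMap.ker L) ≤ Module.finrank ℚ A := by
    have hmem : ∀ c : LinearMap.ker L, (M.comp (LinearMap.ker L).subtype) c ∈ A := by
      rintro ⟨c, hc⟩
      refine hA _ fun d => ?_
      have hcd : c d - c (ι d) = 0 := congrFun (LinearMap.mem_ker.1 hc) d
      change ε (ι d) * c (ι d) = - (ε d * c d)
      rw [hε, show c (ι d) = c d by linarith]
      ring
    exact LinearMap.finrank_le_finrank_of_injective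
      (f := (M.comp (LinearMap.ker L).subtype).codRestrict A hmem)
      fun c c' h => Subtype.ext (hM (congrArg Subtype.val h))
  have h3 := L.finrank_range_add_finrank_ker
  rw [Module.finrank_pi] at h3
  omega

/-! ### Complexity as the dimension of a space of functions -/

namespace FreeSplitting

open SimpleGraph

variable {F : Type u} [Group F] {T : FreeSplitting.{u, v} F}

/-- On a tree with free edgelet orbits, the cocycle becomes independent of the vertex after
subtracting the coboundary of some u. Since a is constant along the edgelets of `β`, u can be chosen
constant on its components, so nothing changes on their stabilizers. -/
theorem exists_additiveFun_of_cocycle (β : T.InvSubgraph) (a : F → T.V → ℚ)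
    (ha : ∀ g h x, a (g * h) x = a g (h • x) + a h x)
    (hβ : ∀ g x y, β.graph.Adj x y → a g x = a g y) :
    ∃ ψ : additiveFun F, ∀ h x, β.graph.Reachable (h • x) x → ψ.1 h = a h x := by
  classical
  let r : T.V × T.V → T.V × T.V := fun p =>
    (Quotient.mk'' p : MulAction.orbitRel.Quotient F (T.V × T.V)).out
  have hr : ∀ p, ∃ s : F, s • r p = p := fun p => by
    have : (MulAction.orbitRel F (T.V × T.V)) p (r p) := Quotient.exact' (Quotient.out_eq' _).symm
    exact this
  choose s hs using hr
  have hrg : ∀ (g : F) p, r (g • p) = r p := fun g p =>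
    congrArg Quotient.out (Quotient.sound' (⟨g, rfl⟩ : (MulAction.orbitRel F (T.V × T.V)) _ _))
  have hsg : ∀ (g : F) (p : T.V × T.V), T.graph.Adj p.1 p.2 → s (g • p) = g * s p := by
    intro g p hp
    have h1 : ((g * s p)⁻¹ * s (g • p)) • r p = r p := by
      rw [mul_smul, inv_smul_eq_iff, mul_smul, hs, ← hrg g p, hs]
    have hrp : T.graph.Adj (r p).1 (r p).2 := by
      rw [← T.smul_adj_iff (s p)]
      have := hs p
      rwa [← show s p • (r p).1 = p.1 from congrArg Prod.fst this,
        ← show s p • (r p).2 = p.2 from congrArg Prod.snd this] at hp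
    have := T.eq_one_of_fix hrp (congrArg Prod.fst h1) (congrArg Prod.snd h1)
    rwa [inv_mul_eq_one, eq_comm] at this
  -- The increments of u are zero on `β`; elsewhere they are zero on orbit representatives and
  -- transported by the law that the cocycle dictates.
  let b₀ : T.V × T.V → ℚ := fun p =>
    if β.graph.Adj p.1 p.2 then 0 else a (s p) (r p).2 - a (s p) (r p).1
  have hb₀ : ∀ g x y, T.graph.Adj x y →
      b₀ (g • x, g • y) = b₀ (x, y) + a g y - a g x := by
    intro g x y hxy
    by_cases h : β.graph.Adj x y
    · simp only [b₀, if_pos h, if_pos (β.smul_adj g _ _ h), hβ g x y h]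
      ring
    · have h' : ¬ β.graph.Adj (g • x) (g • y) := fun h' => h (by
        simpa using β.smul_adj g⁻¹ _ _ h')
      simp only [b₀, if_neg h, if_neg h']
      rw [show ((g • x, g • y) : T.V × T.V) = g • (x, y) from rfl, hsg g (x, y) hxy, hrg, ha, ha,
        show s (x, y) • (r (x, y)).1 = x from congrArg Prod.fst (hs (x, y)),
        show s (x, y) • (r (x, y)).2 = y from congrArg Prod.snd (hs (x, y))]
      ring
  -- The two orientations of an edgelet have independently chosen representatives, hence the
  -- antisymmetrization.
  obtain ⟨u, hu⟩ := T.isTree.exists_potential (fun x y => (b₀ (x, y) - b₀ (y, x)) / 2)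
    (fun x y _ => by ring)
  have huβ : ∀ x y, β.graph.Reachable x y → u x = u y := by
    intro x y h
    refine h.mem_of_closed (A := {z | u x = u z}) rfl ?_
    intro z w hzw hz
    refine Eq.trans hz ?_
    rw [hu z w (β.le hzw)]
    simp only [b₀, if_pos hzw, if_pos hzw.symm]
    ring
  have hconst : ∀ g x y, u (g • y) - u y - a g y = u (g • x) - u x - a g x := by
    intro g x y
    refine (T.isTree.connected x y).mem_of_closed
      (A := {z | u (g • z) - u z - a g z = u (g • x) - u x - a g x}) rfl ?_
    intro z w hzw hz
    refine Eq.trans ?_ hz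
    rw [hu _ _ (T.smul_adj g _ _ hzw), hu z w hzw, hb₀ g z w hzw, hb₀ g w z hzw.symm]
    ring
  obtain ⟨x₀⟩ := T.isTree.connected.nonempty
  refine ⟨⟨fun g => a g x₀ + u x₀ - u (g • x₀), fun g h => ?_⟩, fun h x hx => ?_⟩
  · have := hconst g x₀ (h • x₀)
    simp only [ha, mul_smul]
    linarith
  · have h1 := hconst h x x₀
    have h2 := huβ _ _ hx
    change a h x₀ + u x₀ - u (h • x₀) = a h x
    linarith

namespace InvSubgraph

variable (β : T.InvSubgraph)

theorem mem_compStab_iff {x : T.V} {g : F} :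
    g ∈ β.compStab x ↔ g • β.graph.connectedComponentMk x = β.graph.connectedComponentMk x :=
  ConnectedComponent.eq.symm

/-- Homomorphisms on the stabilizers of components from different orbits extend simultaneously. -/
theorem restrict_surjective {Q : Type*} [Finite Q] (x : Q → T.V)
    (hx : ∀ q q' (g : F), β.graph.Reachable (g • x q) (x q') → q = q') :
    Function.Surjective (additiveFun.restrict fun q => β.compStab (x q)) := by
  classical
  have := Fintype.ofFinite Q
  intro φ
  choose a ha hap ha0 using fun q => exists_cocycle (β.graph.connectedComponentMk (x q))
    (fun _ => β.mem_compStab_iff) (φ q)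
  obtain ⟨ψ, hψ⟩ := exists_additiveFun_of_cocycle β
    (fun g z => ∑ q, a q g (β.graph.connectedComponentMk z))
    (fun g h z => by
      rw [← Finset.sum_add_distrib]
      exact Finset.sum_congr rfl fun q _ => ha q g h _)
    (fun g z w h => by rw [ConnectedComponent.sound h.reachable])
  refine ⟨ψ, funext fun q => Subtype.ext (funext fun h => ?_)⟩
  change ψ.1 h.1 = _
  rw [hψ h.1 (x q) h.2, Finset.sum_eq_single q]
  · exact hap q h
  · intro q' _ hq'
    exact ha0 q' _ (fun g hg => hq' (hx q' q g (ConnectedComponent.exact hg))) _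
  · exact fun h => absurd (Finset.mem_univ _) h

/-- The set of (nondegenerate) components. -/
def Comp : Type v :=
  {c : β.graph.ConnectedComponent // ∃ x y, β.graph.Adj x y ∧ β.graph.connectedComponentMk x = c}

instance : MulAction F β.Comp where
  smul g c := ⟨g • c.1, by
    obtain ⟨x, y, h, hc⟩ := c.2
    exact ⟨g • x, g • y, β.smul_adj g _ _ h, by rw [← hc]; rfl⟩⟩
  one_smul c := Subtype.ext (one_smul F c.1)
  mul_smul g h c := Subtype.ext (mul_smul g h c.1)

/-- The component of a vertex. -/
def Vert.comp {β : T.InvSubgraph} (x : β.Vert) : β.Comp :=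
  ⟨β.graph.connectedComponentMk x.1, by
    obtain ⟨y, hy⟩ := x.2
    exact ⟨x.1, y, hy, rfl⟩⟩

theorem eq_of_reachable_out {q q' : β.CompOrbit} {g : F}
    (h : β.graph.Reachable (g • q.out.1) q'.out.1) : q = q' := by
  rw [← Quotient.out_eq q, ← Quotient.out_eq q']
  exact Quotient.sound ⟨g, h⟩

instance [Group.FG F] : Finite β.CompOrbit := by
  refine Finite.of_injective (fun q : β.CompOrbit =>
    (Quotient.mk'' q.out.1 : MulAction.orbitRel.Quotient F T.V)) ?_
  intro q q' h
  obtain ⟨g, hg⟩ := Quotient.exact' h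
  refine (β.eq_of_reachable_out (g := g) ?_).symm
  rw [show g • q'.out.1 = q.out.1 from hg]

theorem complexity_le [IsFreeGroup F] : β.complexity ≤ Nat.card β.CompOrbit + freeRank F := by
  have : 0 ≤ ∑ᶠ q : β.CompOrbit, (freeRank (β.compStab (Quotient.out q).1) : ℤ) :=
    finsum_nonneg fun _ => Int.natCast_nonneg _
  rw [complexity]
  linarith

section complexity

variable [IsFreeGroup F] [Finite (IsFreeGroup.Generators F)] {β}

/-- Orbits of components contribute C₁ free values, and the translation homomorphisms must vanish on
component stabilizers, which leaves rank F - C₂ dimensions. -/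
theorem finrank_quasiInv_comp (hβ : β.graph ≠ ⊥) : Module.Finite ℚ (quasiInv F β.Comp) ∧
    Nonempty β.Comp ∧ (Module.finrank ℚ (quasiInv F β.Comp) : ℤ) = β.complexity := by
  have := groupFG_of_finite_generators F
  have := Fintype.ofFinite β.CompOrbit
  obtain ⟨a, b, hab⟩ := β.graph.ne_bot_iff_exists_adj.1 hβ
  let c₀ : β.Comp := Vert.comp ⟨a, b, hab⟩
  let y : β.CompOrbit → β.Comp := fun q => q.out.comp
  have hH : ∀ q g, g ∈ β.compStab q.out.1 ↔ g • y q = y q := fun q g =>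
    β.mem_compStab_iff.trans (Subtype.ext_iff (a1 := g • y q) (a2 := y q)).symm
  have horb : ∀ z, ∃ (q : β.CompOrbit) (g : F), g • y q = z := by
    rintro ⟨_, x, x', h, rfl⟩
    let x₁ : β.Vert := ⟨x, x', h⟩
    obtain ⟨g, hg⟩ := Quotient.exact (Quotient.out_eq (Quotient.mk β.orbitSetoid x₁))
    exact ⟨Quotient.mk _ x₁, g, Subtype.ext (ConnectedComponent.sound hg)⟩
  have hdis : ∀ q q' (g : F), g • y q = y q' → q = q' := fun q q' g h =>
    β.eq_of_reachable_out (ConnectedComponent.exact (Subtype.ext_iff.1 h))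
  have hsurj := β.restrict_surjective (fun q : β.CompOrbit => q.out.1)
    (fun q q' g h => β.eq_of_reachable_out h)
  refine ⟨quasiInv.module_finite c₀ hH horb hdis, ⟨c₀⟩, ?_⟩
  have key := quasiInv.finrank_add_sum c₀ hH horb hdis hsurj
  rw [complexity, finsum_eq_sum_of_fintype, Nat.card_eq_fintype_card]
  have key' := congrArg (Nat.cast (R := ℤ)) key
  push_cast at key'
  linarith

theorem one_le_complexity (hβ : β.graph ≠ ⊥) : 1 ≤ β.complexity := by
  obtain ⟨h1, h2, h3⟩ := finrank_quasiInv_comp hβ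
  rw [← h3]
  exact_mod_cast quasiInv.one_le_finrank

/-- The complexity does not increase under maps of pairs. -/
theorem complexity_le_of_preimage {S : FreeSplitting.{u, v} F} {α : S.InvSubgraph} (f : Hom S T)
    (hf : ∀ a b, S.graph.Adj a b → (α.graph.Adj a b ↔ β.graph.Adj (f.toFun a) (f.toFun b)))
    (hβ : β.graph ≠ ⊥) : β.complexity ≤ α.complexity := by
  have hlift : ∀ {a b}, β.graph.Adj a b →
      ∃ x y, α.graph.Adj x y ∧ f.toFun x = a ∧ f.toFun y = b := by
    intro a b hab
    obtain ⟨x, y, hxy, rfl, rfl⟩ := f.isMap.exists_lift (β.le hab)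
    exact ⟨x, y, (hf x y hxy).2 hab, rfl, rfl⟩
  have hα : α.graph ≠ ⊥ := by
    obtain ⟨a, b, hab⟩ := β.graph.ne_bot_iff_exists_adj.1 hβ
    obtain ⟨x, y, hxy, -, -⟩ := hlift hab
    exact α.graph.ne_bot_iff_exists_adj.2 ⟨x, y, hxy⟩
  obtain ⟨hfin, -, h1⟩ := finrank_quasiInv_comp hα
  obtain ⟨-, -, h2⟩ := finrank_quasiInv_comp hβ
  rw [← h1, ← h2]
  let φ : α.graph →g β.graph := ⟨f.toFun, fun {a b} h => (hf a b (α.le h)).1 h⟩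
  let p : α.Comp → β.Comp := fun c => ⟨c.1.map φ, by
    obtain ⟨x, y, h, hc⟩ := c.2
    exact ⟨f.toFun x, f.toFun y, φ.map_adj h, by rw [← hc]; rfl⟩⟩
  have hp : ∀ (g : F) c, p (g • c) = g • p c := by
    rintro g ⟨_, x, y, h, rfl⟩
    exact Subtype.ext (congrArg β.graph.connectedComponentMk (f.isMap.equivariant g x))
  have hps : Function.Surjective p := by
    rintro ⟨_, a, b, h, rfl⟩
    obtain ⟨x, y, hxy, rfl, rfl⟩ := hlift h
    exact ⟨⟨_, x, y, hxy, rfl⟩, rfl⟩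
  -- Components of `α` surject onto those of `β`, so quasi-invariant functions pull back
  -- injectively.
  exact_mod_cast LinearMap.finrank_le_finrank_of_injective (quasiInv.comap_injective hp hps)

end complexity

end InvSubgraph

end FreeSplitting

/-! ### Orbits of edgelets and the bound on natural vertices -/

namespace FreeSplitting

open SimpleGraph

variable {F : Type u} [Group F]

/-- The oriented edgelets. -/
def Dart (T : FreeSplitting.{u, v} F) : Type v := {p : T.V × T.V // T.graph.Adj p.1 p.2}

instance (T : FreeSplitting.{u, v} F) : MulAction F T.Dart where
  smul g d := ⟨(g • d.1.1, g • d.1.2), T.smul_adj g _ _ d.2⟩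
  one_smul d := Subtype.ext (one_smul F d.1)
  mul_smul g h d := Subtype.ext (mul_smul g h d.1)

/-- The orbits of oriented edgelets. -/
abbrev DartOrbit (T : FreeSplitting.{u, v} F) : Type v := MulAction.orbitRel.Quotient F T.Dart

variable {T : FreeSplitting.{u, v} F}

/-- The orbit of an oriented edgelet. -/
def dartOrbit {x y : T.V} (h : T.graph.Adj x y) : T.DartOrbit :=
  Quotient.mk'' ⟨(x, y), h⟩

theorem DartOrbit.ind {P : T.DartOrbit → Prop} (h : ∀ x y (hxy : T.graph.Adj x y), P (dartOrbit hxy))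
    (d : T.DartOrbit) : P d := by
  induction d using Quotient.inductionOn' with
  | _ d => exact h d.1.1 d.1.2 d.2

theorem dartOrbit_eq_iff {x y z w : T.V} (h : T.graph.Adj x y) (h' : T.graph.Adj z w) :
    dartOrbit h = dartOrbit h' ↔ ∃ g : F, g • z = x ∧ g • w = y := by
  refine Quotient.eq''.trans ?_
  constructor
  · rintro ⟨g, hg⟩
    have hg' := congrArg Subtype.val hg
    exact ⟨g, congrArg Prod.fst hg', congrArg Prod.snd hg'⟩
  · rintro ⟨g, rfl, rfl⟩
    exact ⟨g, rfl⟩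

/-- The reversal of orientation. -/
def DartOrbit.rev : T.DartOrbit → T.DartOrbit :=
  Quotient.map' (fun d => ⟨(d.1.2, d.1.1), d.2.symm⟩) (by
    rintro d d' ⟨g, hg⟩
    have hg' := congrArg Subtype.val hg
    exact ⟨g, Subtype.ext (Prod.ext (congrArg Prod.snd hg') (congrArg Prod.fst hg'))⟩)

theorem DartOrbit.rev_mk {x y : T.V} (h : T.graph.Adj x y) :
    (dartOrbit h).rev = dartOrbit h.symm := rfl

theorem DartOrbit.rev_rev (d : T.DartOrbit) : d.rev.rev = d := by
  induction d using DartOrbit.ind with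
  | h x y h => rfl

theorem DartOrbit.rev_ne (d : T.DartOrbit) : d.rev ≠ d := by
  induction d using DartOrbit.ind with
  | h x y h =>
    rw [rev_mk, Ne, dartOrbit_eq_iff]
    rintro ⟨g, h1, h2⟩
    have := T.eq_one_of_swap h h1 h2
    rw [this, one_smul] at h1
    exact h.ne h1

/-- The orbit of the initial vertex. -/
def DartOrbit.start : T.DartOrbit → MulAction.orbitRel.Quotient F T.V :=
  Quotient.map' (fun d => d.1.1) (by
    rintro d d' ⟨g, hg⟩
    exact ⟨g, congrArg (fun e : T.Dart => e.1.1) hg⟩)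

theorem DartOrbit.start_mk {x y : T.V} (h : T.graph.Adj x y) :
    (dartOrbit h).start = Quotient.mk'' x := rfl

instance [Group.FG F] : Finite T.DartOrbit := by
  obtain ⟨E, hE, h⟩ := T.exists_finite_darts
  have : Finite E := hE
  have hfin : Finite {e : E // T.graph.Adj e.1.1 e.1.2} := inferInstance
  refine Finite.of_surjective
    (fun e : {e : E // T.graph.Adj e.1.1 e.1.2} => dartOrbit (T := T) e.2) ?_
  intro d
  induction d using DartOrbit.ind with
  | h x y hxy =>
    obtain ⟨g, hg⟩ := h x y hxy
    exact ⟨⟨⟨_, hg⟩, T.smul_adj g _ _ hxy⟩, (dartOrbit_eq_iff _ _).2 ⟨g, rfl, rfl⟩⟩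

/-- Quasi-invariant functions on the vertices exist in abundance: every antisymmetric invariant
function on the oriented edgelets is the coboundary of one. -/
theorem card_dartOrbit_add_two_le [Group.FG F] [Module.Finite ℚ (quasiInv F T.V)] :
    Nat.card T.DartOrbit + 2 ≤ 2 * Module.finrank ℚ (quasiInv F T.V) := by
  classical
  have := Fintype.ofFinite T.DartOrbit
  obtain ⟨x₀⟩ := T.isTree.connected.nonempty
  have hinv : ∀ (u : quasiInv F T.V) (g : F) x y,
      u.1 (g • y) - u.1 (g • x) = u.1 y - u.1 x := by
    rintro ⟨u, ψ, -, hu⟩ g x y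
    simp only [hu]
    ring
  let δ : quasiInv F T.V →ₗ[ℚ] (T.DartOrbit → ℚ) :=
    { toFun := fun u d => u.1 d.out.1.2 - u.1 d.out.1.1
      map_add' := fun u w => funext fun d => by
        simp only [Submodule.coe_add, Pi.add_apply]
        ring
      map_smul' := fun c u => funext fun d => by
        simp only [Submodule.coe_smul, Pi.smul_apply, RingHom.id_apply, smul_sub] }
  have hδ : ∀ u x y (h : T.graph.Adj x y), δ u (dartOrbit h) = u.1 y - u.1 x := by
    intro u x y h
    obtain ⟨g, h1, h2⟩ := (dartOrbit_eq_iff (dartOrbit h).out.2 h).1 (Quotient.out_eq' (dartOrbit h))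
    change u.1 (dartOrbit h).out.1.2 - u.1 (dartOrbit h).out.1.1 = _
    rw [← h1, ← h2, hinv]
  have hrange : ∀ c : T.DartOrbit → ℚ, (∀ d : T.DartOrbit, c d.rev = - c d) →
      c ∈ LinearMap.range δ := by
    intro c hc
    let b : T.V → T.V → ℚ := fun x y => if h : T.graph.Adj x y then c (dartOrbit h) else 0
    obtain ⟨u, hu⟩ := T.isTree.exists_potential b (fun x y h => by
      simp only [b, dif_pos h, dif_pos h.symm]
      rw [← DartOrbit.rev_mk, hc])
    have hconst : ∀ (g : F) x y, u (g • y) - u y = u (g • x) - u x := by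
      intro g x y
      refine (T.isTree.connected x y).mem_of_closed
        (A := {z | u (g • z) - u z = u (g • x) - u x}) rfl ?_
      intro z w hzw hz
      refine Eq.trans ?_ hz
      rw [hu z w hzw, hu _ _ (T.smul_adj g _ _ hzw)]
      simp only [b, dif_pos hzw, dif_pos (T.smul_adj g _ _ hzw)]
      rw [(dartOrbit_eq_iff (T.smul_adj g _ _ hzw) hzw).2 ⟨g, rfl, rfl⟩]
      ring
    have hmem : u ∈ quasiInv F T.V := by
      refine ⟨fun g => u (g • x₀) - u x₀, fun g h => ?_, fun g x => ?_⟩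
      · have := hconst g x₀ (h • x₀)
        simp only [mul_smul]
        linarith
      · have := hconst g x₀ x
        linarith
    refine ⟨⟨u, hmem⟩, funext fun d => ?_⟩
    induction d using DartOrbit.ind with
    | h x y h =>
      rw [hδ]
      simp only [hu x y h, b, dif_pos h]
      ring
  have h1 := card_le_two_mul_finrank DartOrbit.rev DartOrbit.rev_rev DartOrbit.rev_ne
    (LinearMap.range δ) hrange
  -- Constants have zero coboundary. This extra dimension, doubled, is the summand 2 of the
  -- statement.
  have hone : (fun _ : T.V => (1 : ℚ)) ∈ quasiInv F T.V := ⟨0, zero_mem _, fun _ _ => by simp⟩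
  have h2 : 1 ≤ Module.finrank ℚ (LinearMap.ker δ) := by
    rw [Nat.one_le_iff_ne_zero, Ne, Submodule.finrank_eq_zero]
    intro h
    have hk : (⟨_, hone⟩ : quasiInv F T.V) ∈ LinearMap.ker δ :=
      LinearMap.mem_ker.2 (funext fun d => sub_self _)
    rw [h, Submodule.mem_bot] at hk
    exact one_ne_zero (congrFun (congrArg Subtype.val hk) x₀)
  have h3 := δ.finrank_range_add_finrank_ker
  rw [Nat.card_eq_fintype_card]
  omega

/-- The empty subgraph. -/
def emptySubgraph (T : FreeSplitting.{u, v} F) : T.InvSubgraph where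
  graph := ⊥
  le := bot_le
  smul_adj _ _ _ h := h.elim

theorem mem_compStab_emptySubgraph {x : T.V} {g : F} :
    g ∈ T.emptySubgraph.compStab x ↔ g • x = x :=
  reachable_bot

/-- At every vertex of valence two the subgraph contains both edgelets or none. -/
def InvSubgraph.IsLocallyNatural (β : T.InvSubgraph) : Prop :=
  ∀ x, ¬ T.IsNatural x → ∀ y z, T.graph.Adj x y → T.graph.Adj x z →
    β.graph.Adj x y → β.graph.Adj x z

theorem InvSubgraph.IsLocallyNatural.isNaturalSubgraph {β : T.InvSubgraph}
    (h : β.IsLocallyNatural) : β.IsNaturalSubgraph := by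
  intro p hp
  have hadj : ∀ i (hi : i + 1 < p.length), T.graph.Adj p[i] p[i + 1] :=
    fun i hi => List.isChain_iff_getElem.1 hp.chain i hi
  have step : ∀ i (hi : i + 1 < p.length) (h0 : 1 < p.length),
      (β.graph.Adj p[i] p[i + 1] ↔ β.graph.Adj p[0] p[1]) := by
    intro i
    induction i with
    | zero => exact fun _ _ => Iff.rfl
    | succ i ih =>
      intro hi h0
      rw [← ih (by omega) h0]
      have hnat : ¬ T.IsNatural p[i + 1] := by
        rw [hp.natural_iff]
        omega
      constructor
      · exact fun h' => (h _ hnat _ _ (hadj (i + 1) hi) (hadj i (by omega)).symm h').symm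
      · exact fun h' => h _ hnat _ _ (hadj i (by omega)).symm (hadj (i + 1) hi) h'.symm
  have hinfix : ∀ {a b}, [a, b] <:+: p → ∃ i, ∃ hi : i + 1 < p.length, p[i] = a ∧ p[i + 1] = b := by
    rintro a b ⟨s, t, rfl⟩
    refine ⟨s.length, by simp, ?_, ?_⟩
    · simp
    · simp
  intro a b c d hab hcd hβ
  obtain ⟨i, hi, rfl, rfl⟩ := hinfix hab
  obtain ⟨j, hj, rfl, rfl⟩ := hinfix hcd
  exact (step j hj (by omega)).2 ((step i hi (by omega)).1 hβ)

theorem exists_smul_out (x : T.V) :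
    ∃ g : F, g • (Quotient.mk'' x : MulAction.orbitRel.Quotient F T.V).out = x := by
  have : MulAction.orbitRel F T.V x (Quotient.mk'' x : MulAction.orbitRel.Quotient F T.V).out :=
    Quotient.exact' (Quotient.out_eq' _).symm
  exact this

section count

variable [IsFreeGroup F] [Finite (IsFreeGroup.Generators F)]

/-- There are at most `2 rank F - 2` orbits of natural vertices. -/
theorem card_natural_add_two_le (hT : ∀ x : T.V, 2 ≤ (T.graph.neighborSet x).encard) :
    Nat.card {q : MulAction.orbitRel.Quotient F T.V // T.IsNatural q.out} + 2 ≤ 2 * freeRank F := by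
  classical
  have := groupFG_of_finite_generators F
  have := Fintype.ofFinite T.DartOrbit
  have := Fintype.ofFinite (MulAction.orbitRel.Quotient F T.V)
  obtain ⟨x₀⟩ := T.isTree.connected.nonempty
  let Q := MulAction.orbitRel.Quotient F T.V
  let H : Q → Subgroup F := fun q => T.emptySubgraph.compStab q.out
  have hH : ∀ q g, g ∈ H q ↔ g • q.out = q.out := fun q g => mem_compStab_emptySubgraph
  have horb : ∀ z : T.V, ∃ (q : Q) (g : F), g • q.out = z := fun z =>
    ⟨Quotient.mk'' z, exists_smul_out z⟩
  have hdis : ∀ (q q' : Q) (g : F), g • q.out = q'.out → q = q' := by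
    intro q q' g h
    rw [← Quotient.out_eq' q, ← Quotient.out_eq' q']
    have hr : MulAction.orbitRel F T.V q'.out q.out := ⟨g, h⟩
    exact (Quotient.sound' hr).symm
  have hsurj : Function.Surjective (additiveFun.restrict H) :=
    T.emptySubgraph.restrict_surjective (fun q : Q => q.out)
      (fun q q' g h => hdis q q' g (reachable_bot.1 h))
  have hmod := quasiInv.module_finite x₀ hH horb hdis
  have hcount := quasiInv.finrank_add_sum x₀ hH horb hdis hsurj
  have hdarts := T.card_dartOrbit_add_two_le
  -- An orbit with trivial stabilizer has as many outgoing edgelet orbits as its valence, hence at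
  -- least two, or three if natural. A nontrivial stabilizer has rank at least one, and twice that
  -- plus one edgelet orbit is already three. Summation over q combines with the two dimension
  -- formulas.
  have hfib : ∀ q : Q, 2 + (if T.IsNatural q.out then 1 else 0) ≤
      Fintype.card {d : T.DartOrbit // d.start = q} + 2 * freeRank (H q) := by
    intro q
    by_cases htriv : ∀ g : F, g • q.out = q.out → g = 1
    · have hk : ∀ k : ℕ, (k : ℕ∞) ≤ (T.graph.neighborSet q.out).encard →
          k ≤ Fintype.card {d : T.DartOrbit // d.start = q} := by
        intro k hk
        obtain ⟨n, hn, hadj⟩ := Set.natCast_le_encard_iff.1 hk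
        have hadj' : ∀ i, T.graph.Adj q.out (n i) := hadj
        rw [← Fintype.card_fin k]
        refine Fintype.card_le_of_injective (fun i => ⟨dartOrbit (hadj' i), by
          rw [DartOrbit.start_mk, Quotient.out_eq']⟩) ?_
        intro i j hij
        obtain ⟨g, h1, h2⟩ := (dartOrbit_eq_iff _ _).1 (congrArg Subtype.val hij)
        rw [htriv g h1, one_smul] at h2
        exact (hn h2).symm
      by_cases hnat : T.IsNatural q.out
      · rw [if_pos hnat]
        have := hk 3 hnat
        omega
      · rw [if_neg hnat]
        have := hk 2 (hT _)
        omega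
    · push Not at htriv
      obtain ⟨g, hg, hg1⟩ := htriv
      have := additiveFun.finite_of_restrict_surjective hsurj q
      have := additiveFun.finite_generators (H q)
      have h1 : 1 ≤ freeRank (H q) := one_le_freeRank (g := ⟨g, (hH q g).2 hg⟩)
        (fun h => hg1 (congrArg Subtype.val h))
      obtain ⟨y, hy⟩ := T.exists_adj q.out
      have h2 : 0 < Fintype.card {d : T.DartOrbit // d.start = q} :=
        Fintype.card_pos_iff.2 ⟨⟨dartOrbit hy, by rw [DartOrbit.start_mk, Quotient.out_eq']⟩⟩
      split_ifs <;> omega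
  have hsum := Finset.sum_le_sum fun q (_ : q ∈ Finset.univ) => hfib q
  rw [Finset.sum_add_distrib, Finset.sum_add_distrib, ← Finset.mul_sum, ← Fintype.card_sigma,
    Fintype.card_congr (Equiv.sigmaFiberEquiv (DartOrbit.start (T := T))), Finset.sum_const,
    Finset.card_univ] at hsum
  have hnat : ∑ q : Q, (if T.IsNatural q.out then 1 else 0) =
      Nat.card {q : Q // T.IsNatural q.out} := by
    rw [Finset.sum_boole, Nat.card_eq_fintype_card, Fintype.card_subtype]
    simp
  rw [hnat] at hsum
  rw [Nat.card_eq_fintype_card] at hdarts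
  rw [smul_eq_mul] at hsum
  change _ + ∑ q : Q, freeRank (H q) = Fintype.card Q + freeRank F at hcount
  change Fintype.card Q * 2 + _ ≤ _ at hsum
  change Nat.card {q : Q // T.IsNatural q.out} + 2 ≤ _
  generalize Nat.card {q : Q // T.IsNatural q.out} = n at hsum ⊢
  omega

/-- A component without natural vertices would absorb every adjacent edgelet and fill the tree.
Hence orbits of components inject into orbits of natural vertices, C₁ is at most 2 rank - 2, and the
remaining term is at most rank. -/
theorem InvSubgraph.IsLocallyNatural.complexity_le {β : T.InvSubgraph} (h : β.IsLocallyNatural)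
    (hT : ∀ x : T.V, 2 ≤ (T.graph.neighborSet x).encard)
    (hβ : ∃ a b, T.graph.Adj a b ∧ ¬ β.graph.Adj a b) :
    β.complexity ≤ 3 * freeRank F - 2 := by
  have := groupFG_of_finite_generators F
  have hnat : ∀ q : β.CompOrbit, ∃ x, T.IsNatural x ∧ β.graph.Reachable q.out.1 x := by
    intro q
    by_contra! hcon
    have hall : ∀ z, β.graph.Reachable q.out.1 z → ∀ w, T.graph.Adj z w → β.graph.Adj z w := by
      intro z hz w hzw
      have hex : ∃ y, β.graph.Adj z y :=
        hz.mem_of_closed (A := {z | ∃ y, β.graph.Adj z y}) q.out.2 fun a b hab _ => ⟨a, hab.symm⟩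
      obtain ⟨y, hy⟩ := hex
      exact h z (fun hn => hcon z hn hz) y w (β.le hy) hzw hy
    obtain ⟨a, b, hab, hnot⟩ := hβ
    refine hnot (hall a ((T.isTree.connected q.out.1 a).mem_of_closed
      (A := {z | β.graph.Reachable q.out.1 z}) (Reachable.refl _) ?_) b hab)
    exact fun z w hzw hz => Reachable.trans hz (hall z hz w hzw).reachable
  choose n hn hr using hnat
  have hcard : Nat.card β.CompOrbit ≤
      Nat.card {q : MulAction.orbitRel.Quotient F T.V // T.IsNatural q.out} := by
    refine Nat.card_le_card_of_injective (fun q => ⟨Quotient.mk'' (n q), ?_⟩) ?_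
    · obtain ⟨g, hg⟩ := exists_smul_out (n q)
      rw [← T.isNatural_smul_iff g, hg]
      exact hn q
    · intro q q' hqq
      obtain ⟨g, hg⟩ := Quotient.exact' (congrArg Subtype.val hqq)
      have hg' : g • n q' = n q := hg
      refine (β.eq_of_reachable_out (g := g) ?_).symm
      refine (β.reachable_smul g (hr q')).trans ?_
      rw [hg']
      exact (hr q).symm
  have h1 := card_natural_add_two_le hT
  have h2 := β.complexity_le
  omega

end count

end FreeSplitting

namespace FreeSplitting

open SimpleGraph

variable {F : Type u} [Group F] {S T U : FreeSplitting.{u, v} F}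

/-! ### Vertices of valence two -/

theorem neighborSet_eq_pair {x y z : T.V} (hx : ¬ T.IsNatural x) (hxy : T.graph.Adj x y)
    (hxz : T.graph.Adj x z) (hyz : y ≠ z) : T.graph.neighborSet x = {y, z} := by
  have hle : (T.graph.neighborSet x).encard ≤ 2 := by
    by_contra h
    exact hx (Order.add_one_le_of_lt (not_le.1 h))
  have hsub : ({y, z} : Set T.V) ⊆ T.graph.neighborSet x := by
    rintro w (rfl | rfl)
    exacts [hxy, hxz]
  refine ((Set.finite_of_encard_le_coe (k := 2) hle).eq_of_subset_of_encard_le' hsub ?_).symm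
  rwa [Set.encard_pair hyz]

theorem IsFoldable.not_isNatural {f : S.V → T.V} (hf : IsFoldable S T f) {x : S.V}
    (h : ¬ T.IsNatural (f x)) : ¬ S.IsNatural x := fun hx =>
  h ((hf.three_gates x hx).trans (Set.encard_le_encard (by
    rintro _ ⟨y, hy, rfl⟩
    exact hf.adj hy)))

/-- Over a vertex of valence two, a foldable map is a local isomorphism. -/
theorem IsFoldable.exists_pair {f : S.V → T.V} (hf : IsFoldable S T f) {w : S.V} {y z : T.V}
    (hx : ¬ T.IsNatural (f w)) (hy : T.graph.Adj (f w) y) (hz : T.graph.Adj (f w) z)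
    (hyz : y ≠ z) : ∃ w₁ w₂, S.graph.Adj w w₁ ∧ S.graph.Adj w w₂ ∧ f w₁ = y ∧ f w₂ = z ∧
      ∀ w', S.graph.Adj w w' → w' = w₁ ∨ w' = w₂ := by
  have himg : f '' S.graph.neighborSet w = {y, z} := by
    refine (Set.toFinite _).eq_of_subset_of_encard_le' ?_ ?_
    · rw [← neighborSet_eq_pair hx hy hz hyz]
      rintro _ ⟨w', hw', rfl⟩
      exact hf.adj hw'
    · rw [Set.encard_pair hyz]
      exact hf.two_gates w
  obtain ⟨w₁, h₁, e₁⟩ : y ∈ f '' S.graph.neighborSet w := himg ▸ Or.inl rfl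
  obtain ⟨w₂, h₂, e₂⟩ : z ∈ f '' S.graph.neighborSet w := himg ▸ Or.inr rfl
  have hne : w₁ ≠ w₂ := fun h => hyz (by rw [← e₁, ← e₂, h])
  refine ⟨w₁, w₂, h₁, h₂, e₁, e₂, fun w' hw' => ?_⟩
  have : w' ∈ S.graph.neighborSet w := hw'
  rwa [neighborSet_eq_pair (hf.not_isNatural hx) h₁ h₂ hne] at this

/-- The local condition is used because it moves forward: two edgelets at a valence-two vertex lift
to the two edgelets at one valence-two vertex of the source. -/
theorem IsFoldable.isLocallyNatural {f : S.V → T.V} (hf : IsFoldable S T f) {α : S.InvSubgraph}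
    {β : T.InvSubgraph}
    (h : ∀ a b, S.graph.Adj a b → (α.graph.Adj a b ↔ β.graph.Adj (f a) (f b)))
    (hα : α.IsLocallyNatural) : β.IsLocallyNatural := by
  intro x hx y z hy hz hxy
  obtain ⟨w, rfl⟩ := hf.toIsMap.surjective x
  by_cases hyz : y = z
  · exact hyz ▸ hxy
  · obtain ⟨w₁, w₂, h₁, h₂, rfl, rfl, -⟩ := hf.exists_pair hx hy hz hyz
    exact (h _ _ h₂).1 (hα w (hf.not_isNatural hx) w₁ w₂ h₁ h₂ ((h _ _ h₁).2 hxy))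

/-- The translates of the oriented edgelet `x y`, pulled back by `f`. -/
def IsOver (f : S.V → T.V) (x y : T.V) (u w : S.V) : Prop :=
  S.graph.Adj u w ∧ ∃ g : F, f u = g • x ∧ f w = g • y

theorem IsOver.smul {f : S.V → T.V} (hf : IsMap S T f) {x y : T.V} {u w : S.V}
    (h : IsOver f x y u w) (g : F) : IsOver f x y (g • u) (g • w) := by
  obtain ⟨hadj, k, h1, h2⟩ := h
  exact ⟨S.smul_adj g _ _ hadj, g * k, by rw [hf.equivariant, h1, mul_smul],
    by rw [hf.equivariant, h2, mul_smul]⟩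

theorem isOver_or_iff {f : S.V → T.V} {x y : T.V} {u w : S.V} (h : S.graph.Adj u w) :
    IsOver f x y u w ∨ IsOver f x y w u ↔ ∃ g : F, s(f u, f w) = s(g • x, g • y) := by
  constructor
  · rintro (⟨-, g, h1, h2⟩ | ⟨-, g, h1, h2⟩)
    · exact ⟨g, by rw [h1, h2]⟩
    · exact ⟨g, by rw [h1, h2, Sym2.eq_swap]⟩
  · rintro ⟨g, hg⟩
    rcases Sym2.eq_iff.1 hg with ⟨h1, h2⟩ | ⟨h1, h2⟩
    · exact Or.inl ⟨h, g, h1, h2⟩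
    · exact Or.inr ⟨h.symm, g, h2, h1⟩

section shift

variable {x y z : T.V} (hx : ¬ T.IsNatural x) (hxy : T.graph.Adj x y) (hxz : T.graph.Adj x z)
  (hne : ∀ g : F, s(g • x, g • y) ≠ s(x, z))

include hx hxy hxz hne

/-- If g x were a neighbor of x, so would g⁻¹ x be. Equal neighbors would make g an inversion;
different ones would make g or its inverse carry xy onto xz. Thus translates of x are never
adjacent, and moves at different vertices over them do not interfere. -/
theorem smul_ne_of_valence_two (g : F) : g • x ≠ y ∧ g • x ≠ z := by
  have hyz : y ≠ z := fun h => hne 1 (by rw [one_smul, one_smul, h])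
  have hN := neighborSet_eq_pair hx hxy hxz hyz
  have key : ∀ w, T.graph.Adj x w → g • x = w → g⁻¹ • x = y ∨ g⁻¹ • x = z := by
    rintro w hw rfl
    have : g⁻¹ • x ∈ T.graph.neighborSet x := by
      rw [mem_neighborSet, ← T.smul_adj_iff g, smul_inv_smul]
      exact hw.symm
    rwa [hN] at this
  have swap : ∀ w, T.graph.Adj x w → g • x = w → g⁻¹ • x = w → False := by
    intro w hw h1 h2
    rw [inv_smul_eq_iff] at h2
    have := T.eq_one_of_swap hw h1 h2.symm
    rw [this, one_smul] at h1
    exact hw.ne h1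
  constructor
  · intro h
    rcases key y hxy h with h' | h'
    · exact swap y hxy h h'
    · refine hne g⁻¹ ?_
      rw [h', ← h, inv_smul_smul, Sym2.eq_swap]
  · intro h
    rcases key z hxz h with h' | h'
    · refine hne g ?_
      rw [inv_smul_eq_iff] at h'
      rw [← h', h, Sym2.eq_swap]
    · exact swap z hxz h h'

theorem eq_of_smul_eq_of_valence_two {g g' : F} (h : g • x = g' • x) : g = g' := by
  have hyz : y ≠ z := fun h => hne 1 (by rw [one_smul, one_smul, h])
  have hN := neighborSet_eq_pair hx hxy hxz hyz
  have hk : (g'⁻¹ * g) • x = x := by rw [mul_smul, h, inv_smul_smul]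
  have hmem : (g'⁻¹ * g) • y ∈ T.graph.neighborSet x := by
    have := T.smul_adj (g'⁻¹ * g) _ _ hxy
    rwa [hk] at this
  rw [hN] at hmem
  rcases hmem with h' | h'
  · exact (inv_mul_eq_one.1 (T.eq_one_of_fix hxy hk h')).symm
  · exact absurd (by rw [hk, h']) (hne (g'⁻¹ * g))

theorem not_isOver_both {f : S.V → T.V} {u w : S.V} (h₁ : IsOver f x y u w) (h₂ : IsOver f x z u w) :
    False := by
  have hyz : y ≠ z := fun h => hne 1 (by rw [one_smul, one_smul, h])
  obtain ⟨-, g, e1, e2⟩ := h₁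
  obtain ⟨-, g', e3, e4⟩ := h₂
  have := eq_of_smul_eq_of_valence_two hx hxy hxz hne (e1.symm.trans e3)
  rw [this, e4] at e2
  exact hyz (MulAction.injective _ e2).symm

variable {f : S.V → T.V} (hf : IsFoldable S T f)

include hf

theorem IsFoldable.exists_isOver {u : S.V} {g : F} (hu : f u = g • x) :
    ∃ w₁ w₂, IsOver f x y u w₁ ∧ IsOver f x z u w₂ ∧
      ∀ w', S.graph.Adj u w' → w' = w₁ ∨ w' = w₂ := by
  have hyz : y ≠ z := fun h => hne 1 (by rw [one_smul, one_smul, h])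
  obtain ⟨w₁, w₂, h₁, h₂, e₁, e₂, h⟩ := hf.exists_pair (w := u) (y := g • y) (z := g • z)
    (by rwa [hu, T.isNatural_smul_iff]) (by rw [hu]; exact T.smul_adj g _ _ hxy)
    (by rw [hu]; exact T.smul_adj g _ _ hxz) (fun e => hyz (MulAction.injective g e))
  exact ⟨w₁, w₂, ⟨h₁, g, hu, e₁⟩, ⟨h₂, g, hu, e₂⟩, h⟩

theorem IsFoldable.isOver_unique {u w w' : S.V}
    (h : IsOver f x y u w ∧ IsOver f x y u w' ∨ IsOver f x z u w ∧ IsOver f x z u w') : w = w' := by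
  obtain ⟨g, hg⟩ : ∃ g : F, f u = g • x := by
    rcases h with ⟨⟨-, g, hg, -⟩, -⟩ | ⟨⟨-, g, hg, -⟩, -⟩ <;> exact ⟨g, hg⟩
  obtain ⟨w₁, w₂, h₁, h₂, hall⟩ := hf.exists_isOver hx hxy hxz hne hg
  have key := fun w => not_isOver_both hx hxy hxz hne (f := f) (u := u) (w := w)
  rcases h with ⟨h, h'⟩ | ⟨h, h'⟩
  · have e : ∀ w, IsOver f x y u w → w = w₁ := fun w hw =>
      (hall w hw.1).resolve_right fun e => key w hw (e ▸ h₂)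
    rw [e w h, e w' h']
  · have e : ∀ w, IsOver f x z u w → w = w₂ := fun w hw =>
      (hall w hw.1).resolve_left fun e => key w (e ▸ h₁) hw
    rw [e w h, e w' h']

variable {p p' : S.V → U.V}
  (hpc : ∀ u w, S.graph.Adj u w → (p u = p w ↔ ¬ (IsOver f x y u w ∨ IsOver f x y w u)))
  (hp₁ : ∀ u w, IsOver f x y u w → p' u = p w) (hp₂ : ∀ u, (∀ w, ¬ IsOver f x y u w) → p' u = p u)

include hpc hp₁ hp₂

/-- The map `p'` moves each vertex over x across its edgelet over xy. Only edgelets over xz remain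
uncollapsed, and each takes the image of the adjacent edgelet over xy, directed towards x. -/
theorem IsFoldable.shift_cases {u w : S.V} (huw : S.graph.Adj u w) (h : p' u ≠ p' w) :
    (∃ w₁, IsOver f x y u w₁ ∧ IsOver f x z u w ∧ p' u = p w₁ ∧ p' w = p u) ∨
      ∃ u₁, IsOver f x y w u₁ ∧ IsOver f x z w u ∧ p' w = p u₁ ∧ p' u = p w := by
  have key : ∀ u w, S.graph.Adj u w → p' u ≠ p' w → (∃ g : F, f u = g • x) →
      ∃ w₁, IsOver f x y u w₁ ∧ IsOver f x z u w ∧ p' u = p w₁ ∧ p' w = p u := by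
    rintro u w huw h ⟨g, hg⟩
    obtain ⟨w₁, w₂, h₁, h₂, hall⟩ := hf.exists_isOver hx hxy hxz hne hg
    have hnot : ∀ w, IsOver f x y u w ∨ IsOver f x z u w → ∀ w', ¬ IsOver f x y w w' := by
      rintro w hw w' ⟨-, k, hk, -⟩
      rcases hw with ⟨-, l, -, hl⟩ | ⟨-, l, -, hl⟩
      · refine (smul_ne_of_valence_two hx hxy hxz hne (l⁻¹ * k)).1 ?_
        rw [mul_smul, inv_smul_eq_iff, ← hk, hl]
      · refine (smul_ne_of_valence_two hx hxy hxz hne (l⁻¹ * k)).2 ?_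
        rw [mul_smul, inv_smul_eq_iff, ← hk, hl]
    rcases hall w huw with rfl | rfl
    · exact absurd ((hp₁ _ _ h₁).trans (hp₂ _ (hnot w (Or.inl h₁))).symm) h
    · refine ⟨w₁, h₁, h₂, hp₁ _ _ h₁, (hp₂ _ (hnot w (Or.inr h₂))).trans
        ((hpc u w huw).2 ?_).symm⟩
      rintro (h' | h')
      · exact not_isOver_both hx hxy hxz hne h' h₂
      · exact hnot w (Or.inr h₂) u h'
  by_cases hu : ∃ g : F, f u = g • x
  · exact Or.inl (key u w huw h hu)
  by_cases hw : ∃ g : F, f w = g • x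
  · exact Or.inr (key w u huw.symm h.symm hw)
  exfalso
  have hu' : ∀ w', ¬ IsOver f x y u w' := fun w' h' => hu (h'.2.imp fun _ e => e.1)
  have hw' : ∀ w', ¬ IsOver f x y w w' := fun w' h' => hw (h'.2.imp fun _ e => e.1)
  rw [hp₂ u hu', hp₂ w hw'] at h
  refine h ((hpc u w huw).2 ?_)
  rintro (h' | h')
  · exact hu' _ h'
  · exact hw' _ h'

/-- The collapse map onto the edgelets over `x y`, modified at the vertices over `x`, is the
collapse map onto the edgelets over `x z`. -/
theorem IsFoldable.isCollapse_shift (hp : IsCollapse S U p) : IsCollapse S U p' ∧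
    ∀ u w, S.graph.Adj u w → (p' u = p' w ↔ ¬ (IsOver f x z u w ∨ IsOver f x z w u)) := by
  have hadj : ∀ {u w}, IsOver f x y u w → p u ≠ p w := fun {u w} h e =>
    (hpc u w h.1).1 e (Or.inl h)
  have hover : ∀ {u w}, IsOver f x z u w → p' u ≠ p' w := by
    intro u w h
    obtain ⟨huw, g, hg, hw⟩ := h
    obtain ⟨w₁, w₂, h₁, -, -⟩ := hf.exists_isOver hx hxy hxz hne hg
    have hnot : ∀ w', ¬ IsOver f x y w w' := by
      rintro w' ⟨-, k, hk, -⟩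
      refine (smul_ne_of_valence_two hx hxy hxz hne (g⁻¹ * k)).2 ?_
      rw [mul_smul, inv_smul_eq_iff, ← hk, hw]
    rw [hp₁ _ _ h₁, hp₂ _ hnot]
    have : p u = p w := by
      refine (hpc u w huw).2 ?_
      rintro (h' | h')
      · exact not_isOver_both hx hxy hxz hne h' ⟨huw, g, hg, hw⟩
      · exact hnot _ h'
    rw [← this]
    exact (hadj h₁).symm
  have hcases := fun u w => hf.shift_cases hx hxy hxz hne hpc hp₁ hp₂ (u := u) (w := w)
  refine ⟨⟨⟨fun u w huw => ?_, fun g u => ?_⟩, ?_⟩, fun u w huw => ?_⟩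
  · by_cases h : p' u = p' w
    · exact Or.inl h
    · right
      rcases hcases u w huw h with ⟨w₁, h₁, -, e₁, e₂⟩ | ⟨u₁, h₁, -, e₁, e₂⟩
      · rw [e₁, e₂]
        exact (hp.toIsMap.adj_of_ne h₁.1 (hadj h₁)).symm
      · rw [e₁, e₂]
        exact hp.toIsMap.adj_of_ne h₁.1 (hadj h₁)
  · by_cases h : ∃ w, IsOver f x y u w
    · obtain ⟨w, hw⟩ := h
      rw [hp₁ _ _ hw, hp₁ _ _ (hw.smul hf.toIsMap g), hp.equivariant]
    · push Not at h
      rw [hp₂ u h, hp₂ (g • u), hp.equivariant]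
      intro w hw
      have := hw.smul hf.toIsMap g⁻¹
      rw [inv_smul_smul] at this
      exact h _ this
  · have key : ∀ u w u' w' w₁ w₁', IsOver f x y u w₁ → IsOver f x z u w → IsOver f x y u' w₁' →
        IsOver f x z u' w' → p w₁ = p w₁' → p u = p u' → u = u' ∧ w = w' := by
      intro u w u' w' w₁ w₁' h₁ h₂ h₁' h₂' e₁ e₂
      obtain ⟨rfl, -⟩ := hp.inj_over _ _ _ _ h₁.1 h₁'.1 (hadj h₁) e₂ e₁
      exact ⟨rfl, hf.isOver_unique hx hxy hxz hne (Or.inr ⟨h₂, h₂'⟩)⟩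
    -- Opposite orientations cannot match, because y is not a translate of x.
    have key' : ∀ u u' w₁ w₁', IsOver f x y u w₁ → IsOver f x y u' w₁' →
        p w₁ = p u' → p u = p w₁' → False := by
      intro u u' w₁ w₁' h₁ h₁' e₁ e₂
      obtain ⟨-, rfl⟩ := hp.inj_over _ _ _ _ h₁.1 h₁'.1.symm (hadj h₁) e₂ e₁
      obtain ⟨-, k, -, hk⟩ := h₁
      obtain ⟨-, l, hl, -⟩ := h₁'
      refine (smul_ne_of_valence_two hx hxy hxz hne (k⁻¹ * l)).1 ?_
      rw [mul_smul, inv_smul_eq_iff, ← hk, hl]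
    intro u w u' w' huw huw' h e1 e2
    rcases hcases u w huw h with ⟨w₁, h₁, h₂, e₁, e₂⟩ | ⟨u₁, h₁, h₂, e₁, e₂⟩ <;>
    rcases hcases u' w' huw' (e1 ▸ e2 ▸ h) with ⟨w₁', h₁', h₂', e₁', e₂'⟩ | ⟨u₁', h₁', h₂', e₁', e₂'⟩
    · exact key _ _ _ _ _ _ h₁ h₂ h₁' h₂' (by rw [← e₁, ← e₁', e1]) (by rw [← e₂, ← e₂', e2])
    · exact (key' _ _ _ _ h₁ h₁' (by rw [← e₁, ← e₂', e1]) (by rw [← e₂, ← e₁', e2])).elim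
    · exact (key' _ _ _ _ h₁ h₁' (by rw [← e₁, ← e₂', e2]) (by rw [← e₂, ← e₁', e1])).elim
    · exact (key _ _ _ _ _ _ h₁ h₂ h₁' h₂' (by rw [← e₁, ← e₁', e2])
        (by rw [← e₂, ← e₂', e1])).symm
  · constructor
    · rintro h (h' | h')
      · exact hover h' h
      · exact hover h' h.symm
    · intro h
      by_contra h'
      rcases hcases u w huw h' with ⟨-, -, h2, -⟩ | ⟨-, -, h2, -⟩
      · exact h (Or.inl h2)
      · exact h (Or.inr h2)

end shift

end FreeSplitting

namespace SplittingSeq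

open FreeSplitting SimpleGraph

variable {F : Type u} [Group F]

/-! ### Normalization of the peak -/

/-- If the peak of the last column is the union of its two collapse graphs then their intersection
can be collapsed. -/
theorem exists_normalization [Group.FG F] [IsMulTorsionFree F] {T₁ T₂ T₃ : SplittingSeq.{u, v} F}
    {J : ℕ} {π₁ : ∀ k, (T₂.obj k).V → (T₁.obj k).V} {π₃ : ∀ k, (T₂.obj k).V → (T₃.obj k).V}
    (h₁ : IsCombingRectangle T₂ T₁ π₁ 0 J) (h₃ : IsCombingRectangle T₂ T₃ π₃ 0 J)
    (hpeak : ∀ a b, (T₂.obj J).graph.Adj a b → π₃ J a = π₃ J b ∨ π₁ J a = π₁ J b) :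
    ∃ (T : SplittingSeq.{u, v} F) (q₁ : ∀ k, (T.obj k).V → (T₁.obj k).V)
      (q₃ : ∀ k, (T.obj k).V → (T₃.obj k).V),
      IsCombingRectangle T T₁ q₁ 0 J ∧ IsCombingRectangle T T₃ q₃ 0 J ∧
      ∀ k, k ≤ J → ∀ a b, (T.obj k).graph.Adj a b → (q₃ k a = q₃ k b ↔ q₁ k a ≠ q₁ k b) := by
  have hc₁ := (h₁.collapse J J.zero_le le_rfl).toIsMap
  have hc₃ := (h₃.collapse J J.zero_le le_rfl).toIsMap
  have hadj : ∀ {a b}, ((T₂.obj J).collapseGraph fun x => (π₁ J x, π₃ J x)).graph.Adj a b ↔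
      (T₂.obj J).graph.Adj a b ∧ π₁ J a = π₁ J b ∧ π₃ J a = π₃ J b := by
    intro a b
    constructor
    · rintro ⟨h, h'⟩
      have := h' 1
      rw [one_smul, one_smul] at this
      exact ⟨h, congrArg Prod.fst this, congrArg Prod.snd this⟩
    · rintro ⟨h, e₁, e₃⟩
      refine ⟨h, fun g => Prod.ext ?_ ?_⟩
      · dsimp only
        rw [hc₁.equivariant, hc₁.equivariant, e₁]
      · dsimp only
        rw [hc₃.equivariant, hc₃.equivariant, e₃]
  -- Collapse the edgelets killed by both maps in column J and take preimages in the earlier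
  -- columns.
  obtain ⟨T, p, hp, hpc⟩ := h₁.foldable.exists_collapse
    ((T₂.obj J).collapseGraph fun x => (π₁ J x, π₃ J x)) (by
      obtain ⟨x⟩ := (T₁.obj J).isTree.connected.nonempty
      obtain ⟨y, hxy⟩ := (T₁.obj J).exists_adj x
      obtain ⟨a, b, hab, rfl, rfl⟩ := hc₁.exists_lift hxy
      exact ⟨a, b, hab, fun h => hxy.ne (hadj.1 h).2.1⟩)
  have hpc' : ∀ k, k ≤ J → ∀ a b, (T₂.obj k).graph.Adj a b →
      (p k a = p k b ↔ π₁ k a = π₁ k b ∧ π₃ k a = π₃ k b) := by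
    intro k hk a b hab
    rw [hpc k hk a b hab, hadj, h₁.preimage_trans k.zero_le hk le_rfl hab,
      h₃.preimage_trans k.zero_le hk le_rfl hab]
    exact and_iff_right ((h₁.foldable.trans k.zero_le hk le_rfl).adj hab)
  obtain ⟨q₁, hq₁, e₁⟩ := hp.exists_factor h₁ fun k _ hk a b hab h => ((hpc' k hk a b hab).1 h).1
  obtain ⟨q₃, hq₃, e₃⟩ := hp.exists_factor h₃ fun k _ hk a b hab h => ((hpc' k hk a b hab).1 h).2
  refine ⟨T, q₁, q₃, hq₁, hq₃, fun k hk a b hab => ?_⟩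
  obtain ⟨x, y, hxy, rfl, rfl⟩ := (hp.collapse k k.zero_le hk).toIsMap.exists_lift hab
  have hne := mt (hpc' k hk x y hxy).2 hab.ne
  have hor : π₃ k x = π₃ k y ∨ π₁ k x = π₁ k y := by
    rw [h₁.preimage_trans k.zero_le hk le_rfl hxy, h₃.preimage_trans k.zero_le hk le_rfl hxy]
    exact hpeak _ _ ((h₁.foldable.trans k.zero_le hk le_rfl).adj hxy)
  rw [e₁ k k.zero_le hk, e₁ k k.zero_le hk, e₃ k k.zero_le hk, e₃ k k.zero_le hk]
  tauto

/-! ### Counting free splitting units -/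

variable [IsFreeGroup F]

/-- Consecutive terms at least one unit apart force the integer C to drop strictly, and it has only
the values 1, ..., N available. -/
theorem numUnits_lt {S : SplittingSeq.{u, v} F} {I J : ℕ} (hIJ : I ≤ J) (C : ℕ → ℤ) (N : ℕ)
    (hpos : ∀ i, I ≤ i → i ≤ J → 1 ≤ C i) (hle : ∀ i, I ≤ i → i ≤ J → C i ≤ N)
    (hunit : ∀ i j, I ≤ i → i < j → j ≤ J → C i ≤ C j → S.LtOneUnit i j) : S.numUnits I J < N := by
  have hN : 0 < N := by
    have := (hpos I le_rfl hIJ).trans (hle I le_rfl hIJ)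
    omega
  have hne : {n : ℕ | ∃ i : Fin (n + 1) → ℕ, StrictMono i ∧ I ≤ i 0 ∧ i (Fin.last n) ≤ J ∧
      ∀ l : Fin n, ¬ S.LtOneUnit (i l.castSucc) (i l.succ)}.Nonempty :=
    ⟨0, fun _ => I, fun a b h => absurd (Fin.lt_def.1 h) (by omega), le_rfl, hIJ, fun l => l.elim0⟩
  have hsup : S.numUnits I J ≤ N - 1 := by
    refine csSup_le hne ?_
    rintro n ⟨i, hi, hI, hJ, hl⟩
    have hrange : ∀ l, I ≤ i l ∧ i l ≤ J := fun l =>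
      ⟨hI.trans (hi.monotone (Fin.zero_le l)), (hi.monotone (Fin.le_last l)).trans hJ⟩
    have hstep : ∀ l : Fin n, C (i l.succ) + 1 ≤ C (i l.castSucc) := by
      intro l
      by_contra h
      exact hl l (hunit _ _ (hrange _).1 (hi l.castSucc_lt_succ) (hrange _).2 (by omega))
    have hsum : ∀ l : Fin (n + 1), C (i l) + (l : ℕ) ≤ C (i 0) := by
      intro l
      induction l using Fin.induction with
      | zero => simp
      | succ l ih =>
        have := hstep l
        rw [Fin.val_castSucc] at ih
        rw [Fin.val_succ]
        push_cast
        omega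
    have h1 := hsum (Fin.last n)
    have h2 := hpos _ (hrange (Fin.last n)).1 (hrange (Fin.last n)).2
    have h3 := hle _ (hrange 0).1 (hrange 0).2
    rw [Fin.val_last] at h1
    omega
  omega

/-- An invariant blue-red decomposition of the `T` row which is natural bounds the number of free
splitting units along the `S` row. -/
theorem numUnits_lt_of_isLocallyNatural [Finite (IsFreeGroup.Generators F)] (hF : 2 ≤ freeRank F)
    {S T T₁ T₃ : SplittingSeq.{u, v} F} {I J : ℕ} (hIJ : I ≤ J)
    {π : ∀ k, (S.obj k).V → (T₁.obj k).V} {q₁ : ∀ k, (T.obj k).V → (T₁.obj k).V}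
    {q₃ : ∀ k, (T.obj k).V → (T₃.obj k).V} (hS : IsCombingRectangle S T₁ π 0 J)
    (h₁ : IsCombingRectangle T T₁ q₁ 0 J) (h₃ : IsCombingRectangle T T₃ q₃ 0 J)
    (hq : ∀ k, k ≤ J → ∀ a b, (T.obj k).graph.Adj a b → (q₃ k a = q₃ k b ↔ q₁ k a ≠ q₁ k b))
    (hnat : ((T.obj I).collapseGraph (q₃ I)).IsLocallyNatural) :
    S.numUnits I J < 4 * freeRank F - 3 := by
  let β : ∀ k, (T.obj k).InvSubgraph := fun k => (T.obj k).collapseGraph (q₃ k)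
  let ρ : ∀ k, (T.obj k).InvSubgraph := fun k => (T.obj k).collapseGraph (q₁ k)
  have hβ : ∀ {k}, k ≤ J → ∀ {a b}, (β k).graph.Adj a b ↔
      (T.obj k).graph.Adj a b ∧ q₃ k a = q₃ k b := fun {k} hk {_ _} =>
    (h₃.collapse k k.zero_le hk).toIsMap.collapseGraph_adj
  have hρ : ∀ {k}, k ≤ J → ∀ {a b}, (ρ k).graph.Adj a b ↔
      (T.obj k).graph.Adj a b ∧ q₁ k a = q₁ k b := fun {k} hk {_ _} =>
    (h₁.collapse k k.zero_le hk).toIsMap.collapseGraph_adj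
  have hρβ : ∀ {k}, k ≤ J → ∀ {a b}, (T.obj k).graph.Adj a b →
      ((ρ k).graph.Adj a b ↔ ¬ (β k).graph.Adj a b) := by
    intro k hk a b hab
    rw [hβ hk, hρ hk]
    have := hq k hk a b hab
    tauto
  have hβ' : ∀ {k l} (hkl : k ≤ l) (_ : l ≤ J), ∀ a b, (T.obj k).graph.Adj a b →
      ((β k).graph.Adj a b ↔
        (β l).graph.Adj ((T.trans k l hkl).toFun a) ((T.trans k l hkl).toFun b)) := by
    intro k l hkl hl a b hab
    rw [hβ (hkl.trans hl), hβ hl, h₃.preimage_trans k.zero_le hkl hl hab]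
    exact and_congr_left' (iff_of_true hab ((h₃.foldable.trans k.zero_le hkl hl).adj hab))
  have hβne : ∀ {k}, k ≤ J → (β k).graph ≠ ⊥ := by
    intro k hk
    obtain ⟨x⟩ := (T₁.obj k).isTree.connected.nonempty
    obtain ⟨y, hxy⟩ := (T₁.obj k).exists_adj x
    obtain ⟨a, b, hab, rfl, rfl⟩ := (h₁.collapse k k.zero_le hk).toIsMap.exists_lift hxy
    exact ne_bot_iff_exists_adj.2 ⟨a, b, (hβ hk).2 ⟨hab, (hq k hk a b hab).2 hxy.ne⟩⟩
  have hβproper : ∀ {k}, k ≤ J → ∃ a b, (T.obj k).graph.Adj a b ∧ ¬ (β k).graph.Adj a b := by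
    intro k hk
    obtain ⟨x⟩ := (T₃.obj k).isTree.connected.nonempty
    obtain ⟨y, hxy⟩ := (T₃.obj k).exists_adj x
    obtain ⟨a, b, hab, rfl, rfl⟩ := (h₃.collapse k k.zero_le hk).toIsMap.exists_lift hxy
    exact ⟨a, b, hab, fun h => hxy.ne ((hβ hk).1 h).2⟩
  have hloc : ∀ {k}, I ≤ k → k ≤ J → (β k).IsLocallyNatural := fun {k} hIk hk =>
    (h₃.foldable.trans I.zero_le hIk hk).isLocallyNatural (hβ' hIk hk) hnat
  have hρloc : ∀ {k}, I ≤ k → k ≤ J → (ρ k).IsLocallyNatural := by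
    intro k hIk hk x hx y z hy hz h
    rw [hρβ hk hz]
    exact fun h' => (hρβ hk hy).1 h (hloc hIk hk x hx z y hz hy h')
  -- The bound 3 rank - 2 is at most 4 rank - 3, which is what the conclusion needs.
  have hlt := numUnits_lt (S := S) hIJ (fun k => (β k).complexity) (3 * freeRank F - 2)
    (fun i _ hi => InvSubgraph.one_le_complexity (hβne hi))
    (fun i hIi hi => by
      have := (hloc hIi hi).complexity_le (fun x => by
        have hf := h₃.foldable i i.zero_le hi
        refine (hf.two_gates x).trans (Set.encard_image_le _ _)) (hβproper hi)
      omega) ?_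
  · omega
  intro i j hIi hij hj hC
  -- The row T₁ is a common collapse of S and T, and T carries the decomposition required by
  -- alternative (a).
  refine ⟨T₁, T, π, q₁, hS.mono i.zero_le hj, h₁.mono i.zero_le hj,
    Or.inl ⟨β, ρ, ?_, fun k hik hkj => ?_⟩⟩
  · have hK : ∀ {k}, k ≤ j → k ≤ J := fun h => h.trans hj
    refine ⟨fun k _ hk => ?_, fun k _ hk => ?_, fun k _ hk => hβne (hK hk), fun k _ hk => ?_,
      fun k hk hk' => (hloc (hIi.trans hk) (hK hk')).isNaturalSubgraph,
      fun k hk hk' => (hρloc (hIi.trans hk) (hK hk')).isNaturalSubgraph,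
      fun a b _ hab hb x y hxy => hβ' hab (hK hb) x y hxy, fun a b _ hab hb x y hxy => ?_⟩
    · ext a b
      rw [sup_adj]
      constructor
      · rintro (h | h)
        exacts [(β k).le h, (ρ k).le h]
      · intro h
        rw [hρβ (hK hk) h]
        exact em _
    · ext a b
      rw [inf_adj, bot_adj, iff_false]
      exact fun h => (hρβ (hK hk) ((β k).le h.1)).1 h.2 h.1
    · obtain ⟨a, b, hab, h⟩ := hβproper (hK hk)
      exact ne_bot_iff_exists_adj.2 ⟨a, b, (hρβ (hK hk) hab).2 h⟩
    · rw [hρβ (hab.trans (hK hb)) hxy, hβ' hab (hK hb) x y hxy,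
        hρβ (hK hb) ((h₃.foldable.trans a.zero_le hab (hK hb)).adj hxy)]
  -- Complexity does not increase from i to j, so C i ≤ C j makes it constant in between.
  · have h1 := InvSubgraph.complexity_le_of_preimage (T.trans i k hik) (hβ' hik (hkj.trans hj))
      (hβne (hkj.trans hj))
    have h2 := InvSubgraph.complexity_le_of_preimage (T.trans k j hkj) (hβ' hkj hj) (hβne hj)
    exact le_antisymm h1 (hC.trans h2)

end SplittingSeq

/-! ### Two collapses onto a common row -/

namespace FreeSplitting

variable {F : Type u} [Group F] (T : FreeSplitting.{u, v} F)

/-- The complement of the orbit of an edgelet. -/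
def orbitCompl (x y : T.V) : T.InvSubgraph where
  graph :=
    { Adj := fun a b => T.graph.Adj a b ∧ ∀ g : F, s(a, b) ≠ s(g • x, g • y)
      symm := ⟨fun a b h => ⟨h.1.symm, fun g => by rw [Sym2.eq_swap]; exact h.2 g⟩⟩
      loopless := ⟨fun _ h => h.1.ne rfl⟩ }
  le := fun _ _ h => h.1
  smul_adj := fun g a b h => ⟨T.smul_adj g a b h.1, fun k hk => h.2 (g⁻¹ * k) (by
    have := congrArg (Sym2.map fun w => g⁻¹ • w) hk
    simpa [mul_smul] using this)⟩

theorem isConjugacy_id : IsConjugacy T T (fun x => x) :=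
  ⟨IsHomeomorph.id, fun _ _ => rfl⟩

end FreeSplitting

namespace SplittingSeq

open FreeSplitting

variable {F : Type u} [Group F]

/-- If a vertex of valence two of the last term of a foldable sequence has edgelets `x y`, `x z` in
different orbits, the collapse of the complement of the first orbit and the collapse of the
complement of the second one have the same bottom row. -/
theorem IsFoldableSeq.exists_common_collapse {T : SplittingSeq.{u, v} F} {I : ℕ}
    (hT : T.IsFoldableSeq 0 I) {x y z : (T.obj I).V} (hx : ¬ (T.obj I).IsNatural x)
    (hxy : (T.obj I).graph.Adj x y) (hxz : (T.obj I).graph.Adj x z)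
    (hne : ∀ g : F, s(g • x, g • y) ≠ s(x, z)) :
    ∃ (U : SplittingSeq.{u, v} F) (p p' : ∀ k, (T.obj k).V → (U.obj k).V),
      IsCombingRectangle T U p 0 I ∧ IsCombingRectangle T U p' 0 I ∧
      ∀ k (hk : k ≤ I) a b, (T.obj k).graph.Adj a b →
        (p k a ≠ p k b → ∃ g : F, s((T.trans k I hk).toFun a, (T.trans k I hk).toFun b) =
          s(g • x, g • y)) ∧
        (p' k a ≠ p' k b → ∃ g : F, s((T.trans k I hk).toFun a, (T.trans k I hk).toFun b) =
          s(g • x, g • z)) := by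
  classical
  obtain ⟨U, p, hp, hpc⟩ := hT.exists_collapse ((T.obj I).orbitCompl x y)
    ⟨x, y, hxy, fun h => h.2 1 (by rw [one_smul, one_smul])⟩
  let f : ∀ k, k ≤ I → (T.obj k).V → (T.obj I).V := fun k hk => (T.trans k I hk).toFun
  have hf : ∀ k (hk : k ≤ I), IsFoldable (T.obj k) (T.obj I) (f k hk) := fun k hk =>
    hT k k.zero_le hk
  have hpc' : ∀ k (hk : k ≤ I) a b, (T.obj k).graph.Adj a b → (p k a = p k b ↔
      ¬ (IsOver (f k hk) x y a b ∨ IsOver (f k hk) x y b a)) := by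
    intro k hk a b hab
    rw [hpc k hk a b hab, isOver_or_iff hab, not_exists]
    exact and_iff_right ((hf k hk).adj hab)
  -- A vertex over the orbit of x gets the p-value of its neighbor across the edgelet over xy; the
  -- other vertices keep their p-value.
  let p' : ∀ k, (T.obj k).V → (U.obj k).V := fun k a =>
    if h : ∃ (hk : k ≤ I) (b : (T.obj k).V), IsOver (f k hk) x y a b then p k h.choose_spec.choose
    else p k a
  have hp₁ : ∀ k (hk : k ≤ I) a b, IsOver (f k hk) x y a b → p' k a = p k b := by
    intro k hk a b hab
    have h : ∃ (hk : k ≤ I) (b : (T.obj k).V), IsOver (f k hk) x y a b := ⟨hk, b, hab⟩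
    simp only [p', dif_pos h]
    exact congrArg (p k) ((hf k hk).isOver_unique hx hxy hxz hne
      (Or.inl ⟨h.choose_spec.choose_spec, hab⟩))
  have hp₂ : ∀ k (hk : k ≤ I) a, (∀ b, ¬ IsOver (f k hk) x y a b) → p' k a = p k a := by
    intro k hk a ha
    exact dif_neg fun ⟨_, b, hb⟩ => ha b hb
  have hcol := fun k hk => (hf k hk).isCollapse_shift hx hxy hxz hne (hpc' k hk) (hp₁ k hk)
    (hp₂ k hk) (hp.collapse k k.zero_le hk)
  have hover : ∀ k (hk : k < I) (w : (T.obj I).V) a b, (T.obj k).graph.Adj a b →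
      (IsOver (f (k + 1) hk) x w ((T.map k).toFun a) ((T.map k).toFun b) ↔
        IsOver (f k hk.le) x w a b) := by
    intro k hk w a b hab
    have hadj := (hT.trans k.zero_le k.le_succ hk).adj hab
    rw [trans_succ_self] at hadj
    have e : ∀ c, f (k + 1) hk ((T.map k).toFun c) = f k hk.le c := fun c =>
      (trans_left T hk c).symm
    simp only [IsOver, e, hab, hadj]
  refine ⟨U, p, p', hp, ⟨hT, fun k _ hk => (hcol k hk).1, fun k _ hk a => ?_, fun k _ hk a b hab =>
    ?_⟩, fun k hk a b hab => ⟨fun h => ?_, fun h => ?_⟩⟩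
  · by_cases h : ∃ b, IsOver (f k hk.le) x y a b
    · obtain ⟨b, hb⟩ := h
      rw [hp₁ k hk.le a b hb, hp₁ (k + 1) hk _ _ ((hover k hk y a b hb.1).2 hb)]
      exact hp.comm k k.zero_le hk b
    -- If the image of a lay over the orbit of x, so would a, and the local isomorphism there would
    -- provide an edgelet over xy at a.
    · have h' : ∀ b, ¬ IsOver (f (k + 1) hk) x y ((T.map k).toFun a) b := by
        rintro b ⟨-, g, hg, -⟩
        have hg' : f k hk.le a = g • x := (trans_left T hk a).trans hg
        obtain ⟨w₁, -, hw, -, -⟩ := (hf k hk.le).exists_isOver hx hxy hxz hne hg'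
        exact h ⟨w₁, hw⟩
      rw [hp₂ k hk.le a (not_exists.1 h), hp₂ (k + 1) hk _ h']
      exact hp.comm k k.zero_le hk a
  · have hadj := (hT.trans k.zero_le k.le_succ hk).adj hab
    rw [trans_succ_self] at hadj
    rw [(hcol k hk.le).2 a b hab, (hcol (k + 1) hk).2 _ _ hadj, hover k hk z a b hab,
      hover k hk z b a hab.symm]
  · exact (isOver_or_iff hab).1 (not_not.1 (mt (hpc' k hk a b hab).2 h))
  · exact (isOver_or_iff hab).1 (not_not.1 (mt ((hcol k hk).2 a b hab).2 h))

/-- A map which is equivariant and separates the endpoints of an edgelet separates those of its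
translates. -/
theorem _root_.FreeSplitting.IsMap.ne_of_translate {S T : FreeSplitting.{u, v} F} {f : S.V → T.V}
    (hf : IsMap S T f) {x y a b : S.V} (h : f x ≠ f y) {g : F} (hg : s(a, b) = s(g • x, g • y)) :
    f a ≠ f b := by
  have h' : f (g • x) ≠ f (g • y) := by
    rw [hf.equivariant, hf.equivariant]
    exact fun e => h (MulAction.injective g e)
  rcases Sym2.eq_iff.1 hg with ⟨rfl, rfl⟩ | ⟨rfl, rfl⟩
  exacts [h', h'.symm]

end SplittingSeq

end

theorem mainTheorem5 {F : Type u} [Group F] [IsFreeGroup F]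
    [Finite (IsFreeGroup.Generators F)] (hF : 2 ≤ freeRank F)
    (T0 T1 T2 T3 T4 : SplittingSeq.{u, v} F) (I J : ℕ) (hIJ : I ≤ J)
    (π01 : ∀ k, (T0.obj k).V → (T1.obj k).V)
    (π21 : ∀ k, (T2.obj k).V → (T1.obj k).V)
    (π23 : ∀ k, (T2.obj k).V → (T3.obj k).V)
    (π43 : ∀ k, (T4.obj k).V → (T3.obj k).V)
    (hfold : T0.IsFoldSeq 0 J)
    (h01 : SplittingSeq.IsCombingRectangle T0 T1 π01 0 J)
    (h21 : SplittingSeq.IsCombingRectangle T2 T1 π21 0 J)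
    (h23 : SplittingSeq.IsCombingRectangle T2 T3 π23 0 J)
    (h43 : SplittingSeq.IsCombingRectangle T4 T3 π43 0 J)
    -- the peak of the last column is the union of its two collapse graphs
    (hpeak : ∀ a b : (T2.obj J).V, (T2.obj J).graph.Adj a b →
      π23 J a = π23 J b ∨ π21 J a = π21 J b)
    (hunits : 4 * freeRank F - 3 ≤ T0.numUnits I J) :
    ∃ (Th1 Th3 : SplittingSeq.{u, v} F)
      (q1 : ∀ k, (T1.obj k).V → (Th1.obj k).V)
      (q3 : ∀ k, (T3.obj k).V → (Th3.obj k).V)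
      (ξ : ∀ k, (Th1.obj k).Pt → (Th3.obj k).Pt),
      Th1.IsFoldableSeq 0 I ∧ Th3.IsFoldableSeq 0 I ∧
      -- the two combing rectangles, composed from the given ones and the ones below
      SplittingSeq.IsCombingRectangle T0 Th1 (fun k x => q1 k (π01 k x)) 0 I ∧
      SplittingSeq.IsCombingRectangle T4 Th3 (fun k x => q3 k (π43 k x)) 0 I ∧
      SplittingSeq.IsCombingRectangle T1 Th1 q1 0 I ∧
      SplittingSeq.IsCombingRectangle T3 Th3 q3 0 I ∧
      -- the commutative ladder of conjugacies
      (∀ k, k ≤ I → FreeSplitting.IsConjugacy (Th1.obj k) (Th3.obj k) (ξ k)) ∧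
      (∀ k, k < I → ∀ x : (Th1.obj k).Pt,
        ξ (k + 1) ((Th1.map k).onPt x) = (Th3.map k).onPt (ξ k x)) := by
  have := groupFG_of_finite_generators F
  have := isMulTorsionFree_of_isFreeGroup F
  obtain ⟨T, q₁, q₃, hq₁, hq₃, hq⟩ := SplittingSeq.exists_normalization h21 h23 hpeak
  have hnat : ¬ ((T.obj I).collapseGraph (q₃ I)).IsLocallyNatural := fun h =>
    absurd (SplittingSeq.numUnits_lt_of_isLocallyNatural hF hIJ h01 hq₁ hq₃ hq h)
      (not_lt.2 hunits)
  have hc₁ := (hq₁.collapse I I.zero_le hIJ).toIsMap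
  have hc₃ := (hq₃.collapse I I.zero_le hIJ).toIsMap
  simp only [FreeSplitting.InvSubgraph.IsLocallyNatural, not_forall, hc₃.collapseGraph_adj] at hnat
  -- Failure of local naturality: xy is collapsed in T^3 but survives in T^1, and xz the other way
  -- round.
  obtain ⟨x, hx, y, z, hxy, hxz, ⟨-, hy⟩, hz⟩ := hnat
  have hz₃ : q₃ I x ≠ q₃ I z := fun e => hz ⟨hxz, e⟩
  have hy₁ : q₁ I x ≠ q₁ I y := (hq I hIJ x y hxy).1 hy
  have hz₁ : q₁ I x = q₁ I z := not_not.1 (mt (hq I hIJ x z hxz).2 hz₃)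
  -- The two edgelets lie in different orbits because the equivariant map to T^1 separates the
  -- endpoints of only one of them.
  obtain ⟨U, p, p', hp, hp', hpp⟩ := (hq₁.foldable.mono le_rfl hIJ).exists_common_collapse hx hxy
    hxz (fun g hg => hc₁.ne_of_translate hy₁ hg.symm hz₁)
  -- An edgelet kept by `p` lies over a translate of xy, which `q₁` does not collapse; since
  -- collapse graphs are preimages, `q₁` keeps it too. The same holds for `p'`, xz and `q₃`.
  obtain ⟨r₁, hr₁, -⟩ := (hq₁.mono le_rfl hIJ).exists_factor hp fun k _ hk a b hab e => by
    by_contra h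
    obtain ⟨g, hg⟩ := (hpp k hk a b hab).1 h
    exact hc₁.ne_of_translate hy₁ hg ((hq₁.preimage_trans k.zero_le hk hIJ hab).1 e)
  obtain ⟨r₃, hr₃, -⟩ := (hq₃.mono le_rfl hIJ).exists_factor hp' fun k _ hk a b hab e => by
    by_contra h
    obtain ⟨g, hg⟩ := (hpp k hk a b hab).2 h
    exact hc₃.ne_of_translate hz₃ hg ((hq₃.preimage_trans k.zero_le hk hIJ hab).1 e)
  exact ⟨U, U, r₁, r₃, fun _ x => x, hp.foldable_bottom, hp.foldable_bottom,
    (h01.mono le_rfl hIJ).comp hr₁, (h43.mono le_rfl hIJ).comp hr₃, hr₁, hr₃,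
    fun k _ => (U.obj k).isConjugacy_id, fun _ _ _ => rfl⟩
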